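/- Let $n\ge 0$ be an integer, let $X=\mathbb C^n$ with coordinates $x_1,\dots,x_n$, and let $\xi_n=\prod_{1\le i<j\le n}(x_i-x_j)$ be the Vandermonde determinant. For a partition $\lambda=(\lambda_1\ge\dots\ge\lambda_r)$ of $n$, cut $\{1,\dots,n\}$ into consecutive intervals $P_1,\dots,P_r$ of lengths $\lambda_1,\dots,\lambda_r$, and put $\xi_\lambda=\prod_{t=1}^r\prod_{i<j,\ i,j\in P_t}(x_i-x_j)\in\mathbb C[x_1,\dots,x_n]$. For a function $f$ on a smooth affine complex variety $U$ with ring of differential operators $\mathcal D_U$, the b-function $b_f(s)\in\mathbb C[s]$ is the (monic) minimal polynomial of the operator $s$ on the $\mathcal D_U[s]$-module $\mathcal D_U[s]f^s/\mathcal D_U[s]f^{s+1}$. Let $\widetilde X$ be the blow-up of $X$ along the line $Y=\{x_1=\dots=x_n\}$, let $\widetilde\xi_n$ be the pullback of $\xi_n$ to $\widetilde X$, and let $b_{\widetilde\xi_n}(s)$ be the (monic) least common multiple of the b-functions of the restrictions $\widetilde\xi_n|_U$ over all affine open subsets $U\subseteq\widetilde X$. Then $$b_{\widetilde\xi_n}(s)=\operatorname*{lcm}_{\lambda\vdash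 n,\ \lambda\ne(n)}\bigl(b_{\xi_\lambda}(s)\bigr)\cdot\prod_{i=1}^{\binom n2}\left(s+\frac{i}{\binom n2}\right).$$ (For $n\le 1$, where $Y=X$, the blow-up is empty and both sides equal $1$; empty products and empty least common multiples are $1$, and the unique partition of $0$ is regarded as the partition $(0)$.) -/

import Mathlib

open Polynomial AlgebraicGeometry CategoryTheory

noncomputable section

namespace BernsteinSato

/-! ### The b-function of an element of a commutative `ℂ`-algebra -/

section BFunction

variable {A : Type*} [CommRing A] [Algebra ℂ A] (f : A)
  (B : Type*) [CommRing B] [Algebra ℂ B] [Algebra A B] [IsScalarTower ℂ A B]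
  [IsLocalization.Away f B]

/-- The unique extension of a derivation `δ` of `A` to the localization `B = A[1/f]`
(see `extendAway_algebraMap`). -/
def extendAway (δ : Derivation ℂ A A) : Derivation ℂ B B :=
  letI : Algebra.FormallyEtale A B := Algebra.FormallyEtale.of_isLocalization (Submonoid.powers f)
  LinearMap.compDer
    ((((Algebra.linearMap A B).compDer δ).liftKaehlerDifferential.liftBaseChange B) ∘ₗ
      (KaehlerDifferential.tensorKaehlerEquivOfFormallyEtale ℂ A B).symm.toLinearMap)
    (KaehlerDifferential.D ℂ B)

theorem extendAway_algebraMap (δ : Derivation ℂ A A) (a : A) :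
    extendAway f B δ (algebraMap A B a) = algebraMap A B (δ a) := by
  have : Algebra.FormallyEtale A B := Algebra.FormallyEtale.of_isLocalization (Submonoid.powers f)
  have h : (KaehlerDifferential.tensorKaehlerEquivOfFormallyEtale ℂ A B).symm
      (KaehlerDifferential.D ℂ B (algebraMap A B a)) =
      TensorProduct.tmul A 1 (KaehlerDifferential.D ℂ A a) := by
    rw [LinearEquiv.symm_apply_eq]
    simp [KaehlerDifferential.tensorKaehlerEquivOfFormallyEtale_apply]
  simp [extendAway, h]

/-!
The module `A[1/f][s]·f^s` is free of rank one over `A[1/f][s]` with basis `f^s`. With `B = A[1/f]`,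
the polynomial `m ∈ B[X]` stands for its element `m(s)·f^s`; the polynomial variable is `s`.
-/

/-- The action of a derivation `δ` of `A` on `A[1/f][s]·f^s`:
`δ (m(s) f^s) = (δ(m)(s) + s · (δ f / f) · m(s)) f^s`, where `δ` acts on the coefficients
of `m`. -/
def derivAct (δ : Derivation ℂ A A) : Module.End ℂ B[X] :=
  Polynomial.lsum (fun k =>
    (Polynomial.monomial k).restrictScalars ℂ ∘ₗ (extendAway f B δ).toLinearMap) +
  LinearMap.mulLeft ℂ (X * C (IsLocalization.mk' B (δ f)
    (⟨f, Submonoid.mem_powers f⟩ : Submonoid.powers f)))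

/-- Multiplication by `s`. -/
def sAct : Module.End ℂ B[X] := LinearMap.mulLeft ℂ X

/-- Multiplication by a function `a ∈ A`. -/
def funAct (a : A) : Module.End ℂ B[X] := LinearMap.mulLeft ℂ (C (algebraMap A B a))

/-- The image of `D_A[s]` in the `ℂ`-linear endomorphisms of `A[1/f][s]·f^s`, where `D_A` is the
ring of differential operators generated by the functions and the derivations of `A` (for `A` the
coordinate ring of a smooth affine variety this is the usual ring of differential operators). -/
def diffOps : Subalgebra ℂ (Module.End ℂ B[X]) :=
  Algebra.adjoin ℂ ({sAct B} ∪ Set.range (funAct (A := A) B) ∪ Set.range (derivAct f B))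

/-- The cyclic submodule `D_A[s]·(g f^s)` of `A[1/f][s]·f^s`. -/
def cyclic (g : B[X]) : Submodule ℂ B[X] :=
  (Subalgebra.toSubmodule (diffOps f B)).map (LinearMap.applyₗ g)

theorem mem_cyclic {g m : B[X]} : m ∈ cyclic f B g ↔ ∃ P ∈ diffOps f B, P g = m := by
  simp [cyclic]

/-- `D_A[s]·f^s`. -/
def powS : Submodule ℂ B[X] := cyclic f B 1

/-- `D_A[s]·f^(s+1)`. -/
def powSucc : Submodule ℂ B[X] := cyclic f B (C (algebraMap A B f))

theorem sAct_mem_cyclic {g m : B[X]} (hm : m ∈ cyclic f B g) : sAct B m ∈ cyclic f B g := by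
  obtain ⟨P, hP, rfl⟩ := (mem_cyclic f B).1 hm
  exact (mem_cyclic f B).2 ⟨sAct B * P,
    mul_mem (Algebra.subset_adjoin (Or.inl (Or.inl rfl))) hP, rfl⟩

/-- The operator `s` on `D_A[s]·f^s / D_A[s]·f^(s+1)`. -/
def sQuot : Module.End ℂ (powS f B ⧸ (powSucc f B).submoduleOf (powS f B)) :=
  Submodule.mapQ _ _ ((sAct B).restrict (fun _ hm => sAct_mem_cyclic f B hm))
    (fun _ hm => sAct_mem_cyclic f B hm)

/-- The b-function (Bernstein–Sato polynomial) `b_f(s)`: the minimal polynomial of the operator `s`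
on `D_A[s]·f^s / D_A[s]·f^(s+1)`. -/
def bFunction : ℂ[X] := minpoly ℂ (sQuot f (Localization.Away f))

end BFunction

/-- The monic least common multiple of a (possibly infinite) family of polynomials: the monic
generator of the ideal of common multiples (`0` if `0` is the only common multiple). -/
def polyLcm {ι : Type*} (b : ι → ℂ[X]) : ℂ[X] :=
  normalize (Submodule.IsPrincipal.generator (⨅ i, Ideal.span {b i}))

/-! ### Pullbacks of functions to schemes over an affine scheme -/

section Pullback

variable {R : Type} [CommRing R] {Y : Scheme.{0}} (p : Y ⟶ Spec (CommRingCat.of R))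

/-- The pullback of functions along `p : Y ⟶ Spec R`, restricted to an open subset `U`. -/
def pullbackHom (U : Y.Opens) : R →+* Γ(Y, U) :=
  ((Scheme.ΓSpecIso (CommRingCat.of R)).inv ≫ p.appLE ⊤ U le_top).hom

variable [Algebra ℂ R]

/-- The b-function of the restriction to the open set `U` of the pullback of `h` along `p`, where
`Y` is a scheme over `ℂ` through `p`. -/
def bFunctionOn (h : R) (U : Y.Opens) : ℂ[X] :=
  letI : Algebra ℂ Γ(Y, U) := ((pullbackHom p U).comp (algebraMap ℂ R)).toAlgebra
  bFunction (pullbackHom p U h)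

/-- The b-function of the pullback of `h` along `p : Y ⟶ Spec R`: the least common multiple of the
b-functions of its restrictions to all affine open subsets of `Y`. -/
def bFunctionPullback (h : R) : ℂ[X] :=
  polyLcm fun U : Y.affineOpens => bFunctionOn p h U.1

end Pullback

/-! ### Blow-ups of affine schemes -/

section BlowUp

variable {R : Type} [CommRing R] (I : Ideal R)

/-- The degree `i` part `I^i t^i` of the Rees algebra `⨁ I^i t^i`. -/
def reesGrading (i : ℕ) : Submodule R (reesAlgebra I) :=
  (LinearMap.range (Polynomial.monomial (R := R) i)).comap (reesAlgebra I).val.toLinearMap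

theorem mem_reesGrading {i : ℕ} {x : reesAlgebra I} :
    x ∈ reesGrading I i ↔ ∃ r : R, Polynomial.monomial i r = (x : R[X]) := by
  simp [reesGrading]

/-- The homogeneous component of degree `i` of an element of the Rees algebra. -/
def reesComponent (x : reesAlgebra I) (i : ℕ) : reesGrading I i :=
  ⟨⟨Polynomial.monomial i ((x : R[X]).coeff i), reesAlgebra.monomial_mem.2 (x.2 i)⟩,
    (mem_reesGrading I).2 ⟨_, rfl⟩⟩

instance reesGradedAlgebra : GradedAlgebra (reesGrading I) where
  one_mem := (mem_reesGrading I).2 ⟨1, rfl⟩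
  mul_mem i j x y hx hy := by
    obtain ⟨r, hr⟩ := (mem_reesGrading I).1 hx
    obtain ⟨t, ht⟩ := (mem_reesGrading I).1 hy
    refine (mem_reesGrading I).2 ⟨r * t, ?_⟩
    rw [← Polynomial.monomial_mul_monomial, hr, ht]
    rfl
  decompose' x := ∑ i ∈ (x : R[X]).support, DirectSum.of (fun i => reesGrading I i) i
    (reesComponent I x i)
  left_inv x := by
    apply Subtype.ext
    rw [map_sum, AddSubmonoidClass.coe_finsetSum]
    conv_rhs => rw [(x : R[X]).as_sum_support]
    refine Finset.sum_congr rfl fun i _ => ?_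
    rw [DirectSum.coeAddMonoidHom_of]
    rfl
  right_inv z := by
    have key : ∀ (w : reesAlgebra I) (j : ℕ),
        ((∑ i ∈ (w : R[X]).support, DirectSum.of (fun i => reesGrading I i) i
          (reesComponent I w i)) j) = reesComponent I w j := by
      intro w j
      rw [DFinsupp.finsetSum_apply]
      by_cases hj : (w : R[X]).coeff j = 0
      · rw [Finset.sum_eq_zero]
        · apply Subtype.ext; apply Subtype.ext
          simp [reesComponent, hj]
        · intro i hi
          refine DirectSum.of_eq_of_ne _ _ _ ?_
          rintro rfl
          exact (Polynomial.mem_support_iff.1 hi) hj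
      · rw [Finset.sum_eq_single j]
        · exact DirectSum.of_eq_same _ _
        · intro i _ hij
          exact DirectSum.of_eq_of_ne _ _ _ hij.symm
        · intro h
          exact absurd (Polynomial.mem_support_iff.2 hj) h
    refine DFinsupp.ext fun j => ?_
    rw [key]
    apply Subtype.ext; apply Subtype.ext
    change Polynomial.monomial j _ = _
    induction z using DirectSum.induction_on with
    | zero => simp
    | of i x =>
      rw [DirectSum.coeAddMonoidHom_of]
      obtain ⟨r, hr⟩ := (mem_reesGrading I).1 x.2
      rw [← hr, Polynomial.coeff_monomial]
      by_cases hij : i = j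
      · subst hij
        rw [if_pos rfl, DirectSum.of_eq_same, hr]
      · rw [if_neg hij, DirectSum.of_eq_of_ne _ _ _ (Ne.symm hij)]
        simp
    | add x y hx hy =>
      rw [map_add, DirectSum.add_apply]
      simp only [Subalgebra.coe_add, Submodule.coe_add, Polynomial.coeff_add, map_add, hx, hy]

/-- The blow-up of `Spec R` along the closed subscheme `V(I)`: the `Proj` of the Rees algebra. -/
def blowUp : Scheme.{0} := Proj (reesGrading I)

/-- The blow-down morphism. -/
def blowDown : blowUp I ⟶ Spec (CommRingCat.of R) :=
  Proj.toSpecZero (reesGrading I) ≫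
    Spec.map (CommRingCat.ofHom (algebraMap R (reesGrading I 0)))

end BlowUp

/-! ### Vandermonde determinants -/

section Vandermonde

variable (n : ℕ)

/-- The coordinate ring `ℂ[x_1, …, x_n]` of `ℂ^n`. -/
abbrev CoordRing : Type := MvPolynomial (Fin n) ℂ

variable {n}

/-- `ξ_S = ∏_{i < j, i, j ∈ S} (x_i - x_j)`. -/
def xiSet (S : Finset (Fin n)) : CoordRing n :=
  ∏ q ∈ (S ×ˢ S).filter (fun q => q.1 < q.2), (MvPolynomial.X q.1 - MvPolynomial.X q.2)

variable (n) in
/-- The Vandermonde determinant `ξ_n = ∏_{i < j} (x_i - x_j)`. -/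
def xi : CoordRing n := xiSet Finset.univ

/-- The parts `λ_1 ≥ … ≥ λ_r` of a partition of `n`, in decreasing order. -/
def sortedParts (l : n.Partition) : Composition n where
  blocks := l.parts.sort (· ≥ ·)
  blocks_pos hi := l.parts_pos ((Multiset.mem_sort _).1 hi)
  blocks_sum := by
    rw [← Multiset.sum_coe, Multiset.sort_eq, l.parts_sum]

/-- `ξ_λ = ∏_t ξ_{P_t}`, where `P_1, …, P_r` are the consecutive intervals of lengths
`λ_1 ≥ … ≥ λ_r` that partition the index set. -/
def xiPartition (l : n.Partition) : CoordRing n :=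
  ∏ t : Fin (sortedParts l).length,
    xiSet (Finset.univ.filter fun i : Fin n => (sortedParts l).index i = t)

variable (n) in
/-- The ideal of the line `x_1 = ⋯ = x_n`. -/
def diagonalIdeal : Ideal (CoordRing n) :=
  Ideal.span (Set.range fun q : Fin n × Fin n => MvPolynomial.X q.1 - MvPolynomial.X q.2)

end Vandermonde

end BernsteinSato

end

/-! A polynomial `c` is a multiple of the b-function of `f` exactly when `c(s)·f^s` lies in
`D[s]·f^(s+1)`. Both sides of the theorem are compared through their sets of multiples. Least common
multiples then become conjunctions, and the existence of nonzero b-functions is never needed.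

Take the chart of the blow-up where `u = x_i - x_j` generates the exceptional divisor. There `x_k =
x_j + u v_k` with `v_i = 1` and `v_j = 0`, so the Vandermonde determinant pulls back to `u^d ∏ (v_k
- v_l)` with `d = n.choose 2`. Near a point `a`, the factors with `v_k(a) ≠ v_l(a)` are units. A
linear change of coordinates turns the product of the other differences into `ξ_λ` up to a unit,
where `λ` lists the sizes of the blocks of equal values `v_k(a)`. The values at `i` and `j` differ,
so `λ ≠ (n)`; conversely every such `λ` occurs at a point with `u = 0`, in any chart whose `i` and
`j` lie in different blocks. The differences do not involve `u`, and the power `u^d` multiplies the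
b-function by `∏ (d s + t)`, `1 ≤ t ≤ d`, up to a constant (`bFunction_pow_mul_dvd`,
`exists_of_bFunction_pow_mul_dvd`).

The functions that multiply `c(s)·f^s` into `D[s]·f^(s+1)` form an ideal, `clearIdeal`. For the
upper bound, the local models show that this ideal vanishes at no point of the chart, so it is the
unit ideal (`bFunction_chartFun_dvd`). For the lower bound, at a point with `u = 0` the local model
is an eigenvector of the Euler field centered there, so its b-function is already determined in any
neighbourhood of the point (`clearIdeal_eq_top_of_eulerAt`).

These arguments take place in `K[s]·f^s` with `K` the field of fractions, where a ring and its
localizations can be compared (`bFunction_dvd_iff`). Finally the charts of `Proj` of the Rees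
algebra are identified with affine spaces (`exists_chart_ringEquiv`), and locality of the b-function
extends the result from the charts to all affine open sets (`bFunctionOn_dvd_of_cover`). -/

namespace BernsteinSato

/-! ### The b-function as a membership condition. -/

section MinimalPolynomial

variable {A : Type*} [CommRing A] [Algebra ℂ A] (f : A)
  (B : Type*) [CommRing B] [Algebra ℂ B] [Algebra A B] [IsScalarTower ℂ A B]
  [IsLocalization.Away f B]

/-- The action of a derivation on the coefficients of polynomials. -/
noncomputable def coeffDer {B : Type*} [CommRing B] [Algebra ℂ B] (δ : Derivation ℂ B B) :
    B[X] →ₗ[ℂ] B[X] :=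
  Polynomial.lsum fun k => (Polynomial.monomial k).restrictScalars ℂ ∘ₗ δ.toLinearMap

section CoeffDer

variable {B : Type*} [CommRing B] [Algebra ℂ B] (δ : Derivation ℂ B B)

theorem coeff_coeffDer (p : B[X]) (k : ℕ) : (coeffDer δ p).coeff k = δ (p.coeff k) := by
  rw [coeffDer, Polynomial.lsum_apply, Polynomial.sum_def, Polynomial.finsetSum_coeff]
  simp only [LinearMap.coe_comp, Function.comp_apply, LinearMap.coe_restrictScalars,
    Polynomial.coeff_monomial]
  rw [Finset.sum_ite_eq']
  split_ifs with h
  · rfl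
  · rw [Polynomial.notMem_support_iff.1 h, map_zero]

theorem coeffDer_C (a : B) : coeffDer δ (C a) = C (δ a) := by
  ext k
  rw [coeff_coeffDer, coeff_C, coeff_C]
  split_ifs <;> simp

theorem coeffDer_mul (p q : B[X]) :
    coeffDer δ (p * q) = coeffDer δ p * q + p * coeffDer δ q := by
  ext k
  simp only [coeff_coeffDer, coeff_add, coeff_mul, map_sum, Derivation.leibniz, smul_eq_mul]
  rw [← Finset.sum_add_distrib]
  exact Finset.sum_congr rfl fun x _ => by ring

theorem coeffDer_map (c : ℂ[X]) : coeffDer δ (c.map (algebraMap ℂ B)) = 0 := by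
  ext k
  rw [coeff_coeffDer, coeff_map, Derivation.map_algebraMap, coeff_zero]

theorem coeffDer_map_mul (c : ℂ[X]) (p : B[X]) :
    coeffDer δ (c.map (algebraMap ℂ B) * p) = c.map (algebraMap ℂ B) * coeffDer δ p := by
  rw [coeffDer_mul, coeffDer_map, zero_mul, zero_add]

theorem coeffDer_X_mul (p : B[X]) : coeffDer δ (X * p) = X * coeffDer δ p := by
  simpa using coeffDer_map_mul δ X p

theorem coeffDer_C_mul (a : B) (p : B[X]) :
    coeffDer δ (C a * p) = C (δ a) * p + C a * coeffDer δ p := by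
  rw [coeffDer_mul, coeffDer_C]

end CoeffDer

theorem derivAct_apply (δ : Derivation ℂ A A) (m : B[X]) :
    derivAct f B δ m = coeffDer (extendAway f B δ) m + X * C (IsLocalization.mk' B (δ f)
      (⟨f, Submonoid.mem_powers f⟩ : Submonoid.powers f)) * m := rfl

/-- Polynomials in `s` with complex coefficients are central, because derivations act on the
coefficients only and kill the constants. -/
theorem diffOps_commute {P : Module.End ℂ B[X]} (hP : P ∈ diffOps f B) (c : ℂ[X]) (m : B[X]) :
    P (c.map (algebraMap ℂ B) * m) = c.map (algebraMap ℂ B) * P m := by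
  induction hP using Algebra.adjoin_induction generalizing m with
  | mem P h =>
    rcases h with (h | ⟨a, rfl⟩) | ⟨δ, rfl⟩
    · rw [Set.mem_singleton_iff.1 h]
      simp only [sAct, LinearMap.mulLeft_apply]
      ring
    · simp only [funAct, LinearMap.mulLeft_apply]
      ring
    · rw [derivAct_apply, derivAct_apply, coeffDer_map_mul]
      ring
  | algebraMap r => simp [Module.algebraMap_end_apply]
  | add P Q _ _ hP hQ => rw [LinearMap.add_apply, hP, hQ, LinearMap.add_apply]; ring
  | mul P Q _ _ hP hQ => rw [Module.End.mul_apply, hQ, hP, Module.End.mul_apply]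

theorem map_mul_mem_cyclic {g m : B[X]} (hm : m ∈ cyclic f B g) (c : ℂ[X]) :
    c.map (algebraMap ℂ B) * m ∈ cyclic f B g := by
  induction c using Polynomial.induction_on' generalizing m with
  | add p q hp hq =>
    rw [Polynomial.map_add, add_mul]
    exact add_mem (hp hm) (hq hm)
  | monomial k a =>
    induction k generalizing m with
    | zero =>
      rw [monomial_zero_left, map_C, ← algebraMap_eq, ← Algebra.smul_def, algebraMap_smul]
      exact Submodule.smul_mem _ a hm
    | succ k ih =>
      rw [← monomial_mul_X, Polynomial.map_mul, map_X, mul_assoc]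
      exact ih (sAct_mem_cyclic f B hm)

theorem aeval_sQuot_mk (c : ℂ[X]) (m : powS f B) :
    aeval (sQuot f B) c (Submodule.Quotient.mk m) =
      Submodule.Quotient.mk ⟨c.map (algebraMap ℂ B) * m.1, map_mul_mem_cyclic f B m.2 c⟩ := by
  induction c using Polynomial.induction_on' generalizing m with
  | add p q hp hq =>
    rw [map_add, LinearMap.add_apply, hp, hq, ← Submodule.Quotient.mk_add]
    congr 1
    exact Subtype.ext (by simp [add_mul])
  | monomial k a =>
    induction k generalizing m with
    | zero =>
      rw [monomial_zero_left, aeval_C, Module.algebraMap_end_apply, ← Submodule.Quotient.mk_smul]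
      congr 1
      refine Subtype.ext ?_
      change a • m.1 = (C a).map (algebraMap ℂ B) * m.1
      rw [map_C, ← algebraMap_eq, ← Algebra.smul_def, algebraMap_smul]
    | succ k ih =>
      rw [← monomial_mul_X, map_mul, aeval_X, Module.End.mul_apply]
      have : sQuot f B (Submodule.Quotient.mk m) =
          Submodule.Quotient.mk ⟨sAct B m.1, sAct_mem_cyclic f B m.2⟩ := rfl
      rw [this, ih]
      congr 1
      refine Subtype.ext ?_
      simp only [sAct, LinearMap.mulLeft_apply, Polynomial.map_mul, map_X]
      ring

/-- The quotient is generated over `D[s]` by the class of `f^s`, and `c(s)` commutes with `D[s]`; so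
`c(s)` kills the quotient as soon as it kills this class. If only `0` does, the minimal polynomial
is `0` and the equivalence persists. -/
theorem minpoly_sQuot_dvd_iff (c : ℂ[X]) :
    minpoly ℂ (sQuot f B) ∣ c ↔ c.map (algebraMap ℂ B) ∈ powSucc f B := by
  have hmem : ∀ x : powS f B, x ∈ (powSucc f B).submoduleOf (powS f B) ↔ x.1 ∈ powSucc f B :=
    fun _ => Iff.rfl
  rw [minpoly.dvd_iff]
  constructor
  · intro h
    have h1 : (1 : B[X]) ∈ powS f B := (mem_cyclic f B).2 ⟨1, one_mem _, rfl⟩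
    have := aeval_sQuot_mk f B c ⟨1, h1⟩
    rw [h, LinearMap.zero_apply, eq_comm, Submodule.Quotient.mk_eq_zero,
      hmem] at this
    simpa using this
  · intro h
    refine LinearMap.ext fun x => ?_
    obtain ⟨m, rfl⟩ := Submodule.Quotient.mk_surjective _ x
    rw [aeval_sQuot_mk, LinearMap.zero_apply, Submodule.Quotient.mk_eq_zero,
      hmem]
    obtain ⟨P, hP, hPm⟩ := (mem_cyclic f B).1 m.2
    obtain ⟨Q, hQ, hQc⟩ := (mem_cyclic f B).1 h
    refine (mem_cyclic f B).2 ⟨P * Q, mul_mem hP hQ, ?_⟩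
    have hc := diffOps_commute f B hP c 1
    rw [mul_one] at hc
    exact (congrArg P hQc).trans (hc.trans (congrArg _ hPm))

end MinimalPolynomial

/-! ### The same modules inside polynomials over a field of fractions. -/

section FieldModel

variable {K : Type*} [Field K] [Algebra ℂ K]

/-- The action of a derivation `δ` of a field `K` on `K[s]·f^s`. -/
noncomputable def nabla (f : K) (δ : Derivation ℂ K K) (m : K[X]) : K[X] :=
  coeffDer δ m + X * C (δ f / f) * m

/-- A subspace of `K[s]·f^s` stable under the differential operators of a subalgebra `S`. -/
structure DStable (S : Subalgebra ℂ K) (f : K) (W : Submodule ℂ K[X]) : Prop where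
  X_mul : ∀ m ∈ W, X * m ∈ W
  C_mul : ∀ a ∈ S, ∀ m ∈ W, C a * m ∈ W
  nabla : ∀ δ : Derivation ℂ K K, (∀ a ∈ S, δ a ∈ S) → ∀ m ∈ W, nabla f δ m ∈ W

/-- The submodule `D_S[s]·f^(s+1)` of `K[s]·f^s`. -/
noncomputable def dMod (S : Subalgebra ℂ K) (f : K) : Submodule ℂ K[X] :=
  sInf {W | DStable S f W ∧ C f ∈ W}

theorem dMod_le {S : Subalgebra ℂ K} {f : K} {W : Submodule ℂ K[X]} (hW : DStable S f W)
    (hf : C f ∈ W) : dMod S f ≤ W := sInf_le ⟨hW, hf⟩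

theorem gen_mem_dMod (S : Subalgebra ℂ K) (f : K) : C f ∈ dMod S f :=
  Submodule.mem_sInf.2 fun _ h => h.2

theorem dMod_stable (S : Subalgebra ℂ K) (f : K) : DStable S f (dMod S f) where
  X_mul m hm := Submodule.mem_sInf.2 fun W h => h.1.X_mul m (Submodule.mem_sInf.1 hm W h)
  C_mul a ha m hm := Submodule.mem_sInf.2 fun W h => h.1.C_mul a ha m (Submodule.mem_sInf.1 hm W h)
  nabla δ hδ m hm := Submodule.mem_sInf.2 fun W h =>
    h.1.nabla δ hδ m (Submodule.mem_sInf.1 hm W h)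

theorem map_mul_mem_of_X_mul {W : Submodule ℂ K[X]} (hW : ∀ m ∈ W, X * m ∈ W) (c : ℂ[X])
    {m : K[X]} (hm : m ∈ W) : c.map (algebraMap ℂ K) * m ∈ W := by
  induction c using Polynomial.induction_on' generalizing m with
  | add p q hp hq =>
    rw [Polynomial.map_add, add_mul]
    exact add_mem (hp hm) (hq hm)
  | monomial k a =>
    induction k generalizing m with
    | zero =>
      rw [monomial_zero_left, map_C, ← algebraMap_eq, ← Algebra.smul_def, algebraMap_smul]
      exact Submodule.smul_mem _ a hm
    | succ k ih =>
      rw [← monomial_mul_X, Polynomial.map_mul, map_X, mul_assoc]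
      exact ih (hW _ hm)

theorem nabla_C_mul (f : K) (δ : Derivation ℂ K K) (a : K) (m : K[X]) :
    nabla f δ (C a * m) = C (δ a) * m + C a * nabla f δ m := by
  rw [nabla, nabla, coeffDer_C_mul]; ring

theorem nabla_map_mul (f : K) (δ : Derivation ℂ K K) (c : ℂ[X]) (m : K[X]) :
    nabla f δ (c.map (algebraMap ℂ K) * m) = c.map (algebraMap ℂ K) * nabla f δ m := by
  rw [nabla, nabla, coeffDer_map_mul]; ring

theorem coeffDer_smul_der (a : K) (δ : Derivation ℂ K K) (m : K[X]) :
    coeffDer (a • δ) m = C a * coeffDer δ m := by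
  ext k
  rw [coeff_coeffDer, coeff_C_mul, coeff_coeffDer, Derivation.smul_apply, smul_eq_mul]

theorem nabla_smul_der (f a : K) (δ : Derivation ℂ K K) (m : K[X]) :
    nabla f (a • δ) m = C a * nabla f δ m := by
  rw [nabla, nabla, coeffDer_smul_der, Derivation.smul_apply, smul_eq_mul, mul_div_assoc, C_mul]
  ring

theorem nabla_zero_der (f : K) (m : K[X]) : nabla f 0 m = 0 := by
  simpa using nabla_smul_der f 0 0 m

theorem nabla_add_der (f : K) (δ δ' : Derivation ℂ K K) (m : K[X]) :
    nabla f (δ + δ') m = nabla f δ m + nabla f δ' m := by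
  have : coeffDer (δ + δ') m = coeffDer δ m + coeffDer δ' m := by
    ext k
    simp only [coeff_coeffDer, coeff_add, Derivation.add_apply]
  rw [nabla, nabla, nabla, this, Derivation.add_apply, add_div, C_add]
  ring

theorem nabla_sum_der {ι : Type*} (s : Finset ι) (f : K) (δ : ι → Derivation ℂ K K) (m : K[X]) :
    nabla f (∑ i ∈ s, δ i) m = ∑ i ∈ s, nabla f (δ i) m := by
  classical
  induction s using Finset.induction_on with
  | empty => simp [nabla_zero_der]
  | insert a s ha ih => rw [Finset.sum_insert ha, Finset.sum_insert ha, nabla_add_der, ih]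

/-- The unique extension of a derivation to the field of fractions. -/
theorem exists_derivation_extend {A : Type*} [CommRing A] [IsDomain A] [Algebra ℂ A] [Algebra A K]
    [IsScalarTower ℂ A K] [IsFractionRing A K] (δ : Derivation ℂ A A) :
    ∃ δ' : Derivation ℂ K K, ∀ a, δ' (algebraMap A K a) = algebraMap A K (δ a) := by
  have : Algebra.FormallyEtale A K := Algebra.FormallyEtale.of_isLocalization (nonZeroDivisors A)
  refine ⟨LinearMap.compDer
    ((((Algebra.linearMap A K).compDer δ).liftKaehlerDifferential.liftBaseChange K) ∘ₗ
      (KaehlerDifferential.tensorKaehlerEquivOfFormallyEtale ℂ A K).symm.toLinearMap)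
    (KaehlerDifferential.D ℂ K), fun a => ?_⟩
  have h : (KaehlerDifferential.tensorKaehlerEquivOfFormallyEtale ℂ A K).symm
      (KaehlerDifferential.D ℂ K (algebraMap A K a)) =
      TensorProduct.tmul A 1 (KaehlerDifferential.D ℂ A a) := by
    rw [LinearEquiv.symm_apply_eq]
    simp [KaehlerDifferential.tensorKaehlerEquivOfFormallyEtale_apply]
  simp [h]

/-- The restriction of a derivation to a subalgebra that it preserves, transported along an
injection. -/
theorem exists_derivation_restrict {A : Type*} [CommRing A] [Algebra ℂ A] [Algebra A K]
    [IsScalarTower ℂ A K] (hinj : Function.Injective (algebraMap A K)) (δ : Derivation ℂ K K)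
    (hδ : ∀ a ∈ (IsScalarTower.toAlgHom ℂ A K).range, δ a ∈ (IsScalarTower.toAlgHom ℂ A K).range) :
    ∃ δ' : Derivation ℂ A A, ∀ a, δ (algebraMap A K a) = algebraMap A K (δ' a) := by
  have h : ∀ a : A, ∃ b : A, algebraMap A K b = δ (algebraMap A K a) := fun a =>
    hδ _ ⟨a, rfl⟩
  choose d hd using h
  refine ⟨⟨⟨⟨d, fun x y => hinj ?_⟩, fun r x => hinj ?_⟩, hinj ?_, fun x y => hinj ?_⟩,
    fun a => (hd a).symm⟩
  · simp [hd]
  · have : algebraMap A K (r • x) = r • algebraMap A K x := by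
      rw [algebra_compatible_smul A r x, smul_eq_mul, map_mul, ← IsScalarTower.algebraMap_apply,
        ← Algebra.smul_def]
    have h2 : algebraMap A K (r • d x) = r • algebraMap A K (d x) := by
      rw [algebra_compatible_smul A r (d x), smul_eq_mul, map_mul,
        ← IsScalarTower.algebraMap_apply, ← Algebra.smul_def]
    simp [hd, this, h2]
  · simp [hd]
  · simp [hd]

/-- By the Leibniz rule, agreement at `g` and at `g * b` forces agreement at `b`. With `g` a
denominator of `b`, this extends an identity of derivations from a ring to its localization. -/
theorem derivation_apply_mul_eq {B : Type*} [CommRing B] [Algebra ℂ B] (j : B →+* K)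
    (d : Derivation ℂ B B) (δ' : Derivation ℂ K K) {g b : B} (hg : j g ≠ 0)
    (h1 : δ' (j g) = j (d g)) (h2 : δ' (j (g * b)) = j (d (g * b))) : δ' (j b) = j (d b) := by
  rw [map_mul, Derivation.leibniz, Derivation.leibniz, h1] at h2
  simp only [smul_eq_mul, map_add, map_mul] at h2
  exact mul_left_cancel₀ hg (add_right_cancel h2)

end FieldModel


theorem injective_of_algebraMap_eq {A B K : Type*} [CommRing A] [CommRing B] [Field K]
    [Algebra A B] [Algebra A K] [IsFractionRing A K] (f : A) [IsLocalization.Away f B]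
    {j : B →+* K} (hj : ∀ a, j (algebraMap A B a) = algebraMap A K a) :
    Function.Injective j := by
  rw [injective_iff_map_eq_zero]
  intro b hb
  obtain ⟨⟨a, t⟩, h⟩ := IsLocalization.surj (Submonoid.powers f) b
  have ha : algebraMap A K a = 0 := by rw [← hj, ← h, map_mul, hb, zero_mul]
  rw [IsFractionRing.to_map_eq_zero_iff] at ha
  simp only [ha, map_zero] at h
  exact (IsLocalization.map_units B t).mul_left_eq_zero.1 h

section Comparison

variable {A : Type*} [CommRing A] [IsDomain A] [Algebra ℂ A] {f : A}
  {B : Type*} [CommRing B] [Algebra ℂ B] [Algebra A B] [IsScalarTower ℂ A B]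
  [IsLocalization.Away f B] {K : Type*} [Field K] [Algebra ℂ K] [Algebra A K]
  [IsFractionRing A K]

theorem extendAway_compat (hf : f ≠ 0) {j : B →+* K}
    (hj : ∀ a, j (algebraMap A B a) = algebraMap A K a) {δ : Derivation ℂ A A}
    {δ' : Derivation ℂ K K} (hδ : ∀ a, δ' (algebraMap A K a) = algebraMap A K (δ a)) (b : B) :
    δ' (j b) = j (extendAway f B δ b) := by
  obtain ⟨⟨a, ⟨t, n, ht⟩⟩, h⟩ := IsLocalization.surj (Submonoid.powers f) b
  simp only at h ht
  have key : ∀ a : A, δ' (j (algebraMap A B a)) = j (extendAway f B δ (algebraMap A B a)) := by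
    intro a
    rw [extendAway_algebraMap, hj, hj, hδ]
  refine derivation_apply_mul_eq (g := algebraMap A B t) j _ δ' ?_ (key _) ?_
  · rw [hj, Ne, IsFractionRing.to_map_eq_zero_iff, ← ht]
    exact pow_ne_zero _ hf
  · rw [mul_comm, h]
    exact key _

theorem map_derivAct (hf : f ≠ 0) {j : B →+* K}
    (hj : ∀ a, j (algebraMap A B a) = algebraMap A K a) {δ : Derivation ℂ A A}
    {δ' : Derivation ℂ K K} (hδ : ∀ a, δ' (algebraMap A K a) = algebraMap A K (δ a)) (m : B[X]) :
    (derivAct f B δ m).map j = nabla (algebraMap A K f) δ' (m.map j) := by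
  have h1 : (coeffDer (extendAway f B δ) m).map j = coeffDer δ' (m.map j) := by
    ext k
    rw [coeff_map, coeff_coeffDer, coeff_coeffDer, coeff_map, extendAway_compat hf hj hδ]
  have hf' : algebraMap A K f ≠ 0 := by rwa [Ne, IsFractionRing.to_map_eq_zero_iff]
  have h2 : j (IsLocalization.mk' B (δ f) (⟨f, Submonoid.mem_powers f⟩ : Submonoid.powers f)) =
      δ' (algebraMap A K f) / algebraMap A K f := by
    rw [eq_div_iff hf', ← hj f, ← map_mul, hj f, hδ, ← hj]
    congr 1
    exact IsLocalization.mk'_spec B _ _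
  rw [derivAct_apply, nabla, Polynomial.map_add, h1, Polynomial.map_mul, Polynomial.map_mul,
    map_X, map_C, h2]

variable [IsScalarTower ℂ A K]

/-- One direction is minimality of `dMod`, applied to the image of `powSucc`; the other checks that
the generators of `diffOps` preserve `dMod`. The derivations on both sides match: those of `A`
extend to `K`, and those of `K` preserving `A` restrict to it. -/
theorem map_mem_dMod_iff (hf : f ≠ 0) {j : B →ₐ[ℂ] K}
    (hj : ∀ a, j (algebraMap A B a) = algebraMap A K a) (m : B[X]) :
    m.map (j : B →+* K) ∈ dMod (IsScalarTower.toAlgHom ℂ A K).range (algebraMap A K f) ↔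
      m ∈ powSucc f B := by
  have hj' : ∀ a, (j : B →+* K) (algebraMap A B a) = algebraMap A K a := hj
  have hinj := Polynomial.map_injective (j : B →+* K) (injective_of_algebraMap_eq f hj')
  constructor
  · intro h
    have hW : DStable (IsScalarTower.toAlgHom ℂ A K).range (algebraMap A K f)
        ((powSucc f B).map (Polynomial.mapAlgHom j).toLinearMap) := by
      refine ⟨?_, ?_, ?_⟩
      · rintro _ ⟨m, hm, rfl⟩
        exact ⟨_, sAct_mem_cyclic f B hm, by simp [sAct]⟩
      · rintro _ ⟨a, rfl⟩ _ ⟨m, hm, rfl⟩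
        obtain ⟨P, hP, rfl⟩ := (mem_cyclic f B).1 hm
        refine ⟨_, (mem_cyclic f B).2 ⟨funAct B a * P, mul_mem (Algebra.subset_adjoin
          (Or.inl (Or.inr ⟨a, rfl⟩))) hP, rfl⟩, ?_⟩
        simp [funAct, hj]
      · rintro δ hδ _ ⟨m, hm, rfl⟩
        obtain ⟨P, hP, rfl⟩ := (mem_cyclic f B).1 hm
        obtain ⟨δ', hδ'⟩ := exists_derivation_restrict (IsFractionRing.injective A K) δ hδ
        exact ⟨_, (mem_cyclic f B).2 ⟨derivAct f B δ' * P, mul_mem (Algebra.subset_adjoin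
          (Or.inr ⟨δ', rfl⟩)) hP, rfl⟩, map_derivAct hf hj' hδ' _⟩
    obtain ⟨m', hm', h'⟩ := dMod_le hW ⟨C (algebraMap A B f),
      (mem_cyclic f B).2 ⟨1, one_mem _, rfl⟩, by simp [hj]⟩ h
    exact hinj h' ▸ hm'
  · intro h
    obtain ⟨P, hP, rfl⟩ := (mem_cyclic f B).1 h
    have hst := dMod_stable (IsScalarTower.toAlgHom ℂ A K).range (algebraMap A K f)
    have key : ∀ m : B[X], m.map (j : B →+* K) ∈
        dMod (IsScalarTower.toAlgHom ℂ A K).range (algebraMap A K f) → (P m).map (j : B →+* K) ∈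
        dMod (IsScalarTower.toAlgHom ℂ A K).range (algebraMap A K f) := by
      clear h
      induction hP using Algebra.adjoin_induction with
      | mem P h =>
        intro m hm
        rcases h with (h | ⟨a, rfl⟩) | ⟨δ, rfl⟩
        · rw [Set.mem_singleton_iff.1 h]
          simpa [sAct] using hst.X_mul _ hm
        · have := hst.C_mul (algebraMap A K a) ⟨a, rfl⟩ _ hm
          rw [← hj' a] at this
          simpa only [funAct, LinearMap.mulLeft_apply, Polynomial.map_mul, map_C] using this
        · obtain ⟨δ', hδ'⟩ := exists_derivation_extend (K := K) δ
          rw [map_derivAct hf hj' hδ']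
          refine hst.nabla δ' ?_ _ hm
          rintro _ ⟨a, rfl⟩
          exact ⟨δ a, (hδ' a).symm⟩
      | algebraMap r =>
        intro m hm
        rw [Module.algebraMap_end_apply]
        have : (r • m).map (j : B →+* K) = r • m.map (j : B →+* K) :=
          (Polynomial.mapAlgHom j).map_smul_of_tower r m
        rw [this]
        exact Submodule.smul_mem _ _ hm
      | add P Q _ _ hP hQ =>
        intro m hm
        rw [LinearMap.add_apply, Polynomial.map_add]
        exact add_mem (hP m hm) (hQ m hm)
      | mul P Q _ _ hP hQ =>
        intro m hm
        exact hP _ (hQ m hm)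
    refine key _ ?_
    rw [map_C, hj']
    exact gen_mem_dMod _ _

/-- The working form of the b-function: the right side depends on `A` only through its image in `K`.
-/
theorem bFunction_dvd_iff (K : Type*) [Field K] [Algebra ℂ K] [Algebra A K]
    [IsScalarTower ℂ A K] [IsFractionRing A K] (hf : f ≠ 0) (c : ℂ[X]) :
    bFunction f ∣ c ↔ c.map (algebraMap ℂ K) ∈
      dMod (IsScalarTower.toAlgHom ℂ A K).range (algebraMap A K f) := by
  have hu : IsUnit (algebraMap A K f) :=
    IsUnit.mk0 _ (by rwa [Ne, IsFractionRing.to_map_eq_zero_iff])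
  have hj0 : ∀ a, IsLocalization.Away.lift (S := Localization.Away f) f hu (algebraMap A _ a) =
      algebraMap A K a := fun a => IsLocalization.Away.lift_eq f hu a
  let j : Localization.Away f →ₐ[ℂ] K :=
    { IsLocalization.Away.lift (S := Localization.Away f) f hu with
      commutes' := fun r => by
        rw [IsScalarTower.algebraMap_apply ℂ A (Localization.Away f),
          IsScalarTower.algebraMap_apply ℂ A K]
        exact hj0 _ }
  rw [bFunction, minpoly_sQuot_dvd_iff, ← map_mem_dMod_iff (K := K) hf (j := j) hj0,
    Polynomial.map_map]
  congr! 3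
  exact j.comp_algebraMap

end Comparison


/-! ### Behaviour under localization and multiplication by units. -/

section Localization

variable {K : Type*} [Field K] [Algebra ℂ K] {S S' : Subalgebra ℂ K} {f h : K}

/-- By the quotient rule a derivation that preserves `S` also preserves `S'`. -/
theorem dMod_le_of_localization (hle : S ≤ S') (hinv : h⁻¹ ∈ S') (hh : h ∈ S) (h0 : h ≠ 0)
    (hloc : ∀ a ∈ S', ∃ N : ℕ, h ^ N * a ∈ S) : dMod S f ≤ dMod S' f := by
  have hst := dMod_stable S' f
  refine dMod_le ⟨hst.X_mul, fun a ha => hst.C_mul a (hle ha), fun δ hδ => hst.nabla δ ?_⟩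
    (gen_mem_dMod S' f)
  intro a ha
  obtain ⟨N, hN⟩ := hloc a ha
  have h1 : δ a = (h⁻¹) ^ N * (δ (h ^ N * a) - a * δ (h ^ N)) := by
    rw [Derivation.leibniz, smul_eq_mul, smul_eq_mul, add_sub_cancel_right, ← mul_assoc, inv_pow,
      inv_mul_cancel₀ (pow_ne_zero _ h0), one_mul]
  rw [h1]
  exact mul_mem (pow_mem hinv N) (sub_mem (hle (hδ _ hN))
    (mul_mem ha (hle (hδ _ (pow_mem hh N)))))

/-- The images of the finitely many generators have a common denominator, and the Leibniz rule
propagates it to all of `S`. -/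
theorem exists_pow_mul_derivation (hfg : S.FG) (hle : S ≤ S') (hh : h ∈ S)
    (hloc : ∀ a ∈ S', ∃ N : ℕ, h ^ N * a ∈ S) (δ : Derivation ℂ K K) (hδ : ∀ a ∈ S', δ a ∈ S') :
    ∃ N : ℕ, ∀ a ∈ S, h ^ N * δ a ∈ S := by
  classical
  obtain ⟨t, rfl⟩ := hfg
  choose! k hk using hloc
  refine ⟨∑ x ∈ t, k (δ x), fun a ha => ?_⟩
  induction ha using Algebra.adjoin_induction with
  | mem x hx =>
    rw [← Finset.add_sum_erase t _ hx, pow_add, mul_comm (h ^ _), mul_assoc]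
    exact mul_mem (pow_mem hh _) (hk _ (hδ x (hle (Algebra.subset_adjoin hx))))
  | algebraMap r => simp
  | add x y _ _ hx hy => rw [map_add, mul_add]; exact add_mem hx hy
  | mul x y hx hy ihx ihy =>
    have : h ^ (∑ x ∈ t, k (δ x)) * δ (x * y) =
        x * (h ^ (∑ x ∈ t, k (δ x)) * δ y) + y * (h ^ (∑ x ∈ t, k (δ x)) * δ x) := by
      rw [Derivation.leibniz, smul_eq_mul, smul_eq_mul]; ring
    rw [this]
    exact add_mem (mul_mem hx ihy) (mul_mem hy ihx)

/-- The elements that some power of `h` carries into `dMod S f` form a subspace stable under the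
operators of `S'`, so it contains `dMod S' f`. -/
theorem exists_pow_mul_mem_dMod (hfg : S.FG) (hle : S ≤ S') (hh : h ∈ S)
    (hloc : ∀ a ∈ S', ∃ N : ℕ, h ^ N * a ∈ S) {m : K[X]} (hm : m ∈ dMod S' f) :
    ∃ N : ℕ, C (h ^ N) * m ∈ dMod S f := by
  have hst := dMod_stable S f
  have hup : ∀ {m : K[X]} {N k : ℕ}, C (h ^ N) * m ∈ dMod S f → C (h ^ (k + N)) * m ∈ dMod S f := by
    intro m N k hm
    rw [pow_add, C_mul, mul_assoc]
    exact hst.C_mul _ (pow_mem hh k) _ hm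
  let W : Submodule ℂ K[X] :=
    { carrier := {m | ∃ N : ℕ, C (h ^ N) * m ∈ dMod S f}
      add_mem' := by
        rintro a b ⟨N, hN⟩ ⟨N', hN'⟩
        refine ⟨N + N', ?_⟩
        rw [mul_add]
        refine add_mem ?_ (hup hN')
        rw [add_comm N]
        exact hup hN
      zero_mem' := ⟨0, by simp⟩
      smul_mem' := by
        rintro r m ⟨N, hN⟩
        refine ⟨N, ?_⟩
        rw [mul_smul_comm]
        exact Submodule.smul_mem _ _ hN }
  have hW : DStable S' f W := by
    refine ⟨?_, ?_, ?_⟩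
    · rintro m ⟨N, hN⟩
      refine ⟨N, ?_⟩
      rw [mul_left_comm]
      exact hst.X_mul _ hN
    · rintro a ha m ⟨N, hN⟩
      obtain ⟨k, hk⟩ := hloc a ha
      refine ⟨k + N, ?_⟩
      rw [pow_add, C_mul, mul_mul_mul_comm, ← C_mul]
      exact hst.C_mul _ hk _ hN
    · rintro δ hδ m ⟨N, hN⟩
      obtain ⟨k, hk⟩ := exists_pow_mul_derivation hfg hle hh hloc δ hδ
      -- `h ^ k • δ` preserves `S`; the extra factor `h` makes up for the exponent lost in `δ (h ^
      -- N) = N h^(N-1) δ h`.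
      refine ⟨1 + k + N, ?_⟩
      have h1 : C (h ^ (1 + k + N)) * nabla f δ m =
          C h * nabla f (h ^ k • δ) (C (h ^ N) * m) -
            C (N * (h ^ k * δ h)) * (C (h ^ N) * m) := by
        rw [nabla_smul_der, nabla_C_mul, Derivation.leibniz_pow]
        rcases N with _ | N
        · simp [pow_succ', pow_add]; ring
        · simp only [pow_succ', pow_add, C_mul, Nat.add_sub_cancel, nsmul_eq_mul, smul_eq_mul,
            pow_zero, mul_one]
          ring
      rw [h1]
      exact sub_mem (hst.C_mul _ hh _ (hst.nabla _ hk _ hN))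
        (hst.C_mul _ (mul_mem (natCast_mem S N) (hk _ hh)) _ hN)
  exact dMod_le hW ⟨0, by simpa using gen_mem_dMod S f⟩ hm

/-- The logarithmic derivatives of `u * f` and `f` differ by `u⁻¹ * δ u ∈ S`, so the two actions of
`δ` differ by an operator that stable subspaces absorb. -/
theorem dMod_unit_mul_le {u : K} (hu : u ∈ S) (hu' : u⁻¹ ∈ S) (hu0 : u ≠ 0) (hf : f ≠ 0) :
    dMod S (u * f) ≤ dMod S f := by
  have hst := dMod_stable S f
  refine dMod_le ⟨hst.X_mul, hst.C_mul, fun δ hδ m hm => ?_⟩ ?_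
  · have : nabla (u * f) δ m = nabla f δ m + X * (C (u⁻¹ * δ u) * m) := by
      have : δ (u * f) / (u * f) = δ f / f + u⁻¹ * δ u := by
        rw [Derivation.leibniz, smul_eq_mul, smul_eq_mul]
        field_simp
      rw [nabla, nabla, this, C_add]
      ring
    rw [this]
    exact add_mem (hst.nabla δ hδ m hm)
      (hst.X_mul _ (hst.C_mul _ (mul_mem hu' (hδ _ hu)) _ hm))
  · rw [C_mul]
    exact hst.C_mul _ hu _ (gen_mem_dMod S f)

end Localization

/-! ### Invariance and locality of the b-function. -/

section Intrinsic

variable {A : Type*} [CommRing A] [IsDomain A] [Algebra ℂ A] {f : A}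

theorem bFunction_dvd_of_algEquiv {A' : Type*} [CommRing A'] [IsDomain A'] [Algebra ℂ A']
    (e : A ≃ₐ[ℂ] A') (hf : f ≠ 0) (c : ℂ[X]) : bFunction (e f) ∣ c ↔ bFunction f ∣ c := by
  let K := FractionRing A'
  let _ : Algebra A K := ((algebraMap A' K).comp (e : A →+* A')).toAlgebra
  have htower : IsScalarTower ℂ A K := IsScalarTower.of_algebraMap_eq fun r => by
    change _ = algebraMap A' K (e (algebraMap ℂ A r))
    rw [e.commutes, ← IsScalarTower.algebraMap_apply]
  have hfrac : IsFractionRing A K :=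
    (IsFractionRing.isFractionRing_iff_of_base_ringEquiv K e.symm.toRingEquiv).1 inferInstance
  have hef : e f ≠ 0 := by simpa using hf
  rw [bFunction_dvd_iff K hf, bFunction_dvd_iff K hef]
  have : (IsScalarTower.toAlgHom ℂ A K).range = (IsScalarTower.toAlgHom ℂ A' K).range := by
    ext x
    constructor
    · rintro ⟨a, rfl⟩
      exact ⟨e a, rfl⟩
    · rintro ⟨a, rfl⟩
      refine ⟨e.symm a, ?_⟩
      change algebraMap A' K (e (e.symm a)) = algebraMap A' K a
      rw [e.apply_symm_apply]
  rw [this]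
  rfl

theorem bFunction_dvd_of_associated {g : A} (hfg : Associated f g) (hf : f ≠ 0) {c : ℂ[X]}
    (hc : bFunction f ∣ c) : bFunction g ∣ c := by
  obtain ⟨u, rfl⟩ := hfg.symm
  have hg : g ≠ 0 := left_ne_zero_of_mul hf
  rw [bFunction_dvd_iff (FractionRing A) hf, mul_comm, map_mul] at hc
  rw [bFunction_dvd_iff (FractionRing A) hg]
  refine dMod_unit_mul_le (S := (IsScalarTower.toAlgHom ℂ A (FractionRing A)).range)
    (AlgHom.mem_range_self _ u.1) (?_ : _ ∈ (IsScalarTower.toAlgHom ℂ A _).range) ?_ ?_ hc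
  · refine ⟨(u⁻¹).1, ?_⟩
    refine eq_inv_of_mul_eq_one_left ?_
    change algebraMap A (FractionRing A) _ * algebraMap A (FractionRing A) _ = 1
    rw [← map_mul, Units.inv_mul, map_one]
  · simp
  · simpa using hg

/-- The ideal of the functions that multiply `c(s)·f^s` into `D_A[s]·f^(s+1)`. -/
noncomputable def clearIdeal (f : A) (c : ℂ[X]) : Ideal A where
  carrier := {a | C (algebraMap A (FractionRing A) a) * c.map (algebraMap ℂ (FractionRing A)) ∈
    dMod (IsScalarTower.toAlgHom ℂ A (FractionRing A)).range (algebraMap A _ f)}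
  zero_mem' := by simp
  add_mem' {a b} ha hb := by
    rw [Set.mem_ofPred_eq, map_add, C_add, add_mul]
    exact add_mem ha hb
  smul_mem' a b hb := by
    rw [Set.mem_ofPred_eq, smul_eq_mul, map_mul, C_mul, mul_assoc]
    exact (dMod_stable _ _).C_mul _ (AlgHom.mem_range_self _ a) _ hb

theorem mem_clearIdeal {c : ℂ[X]} {a : A} : a ∈ clearIdeal f c ↔
    C (algebraMap A (FractionRing A) a) * c.map (algebraMap ℂ (FractionRing A)) ∈
      dMod (IsScalarTower.toAlgHom ℂ A (FractionRing A)).range (algebraMap A _ f) := Iff.rfl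

theorem clearIdeal_eq_top_iff (hf : f ≠ 0) (c : ℂ[X]) :
    clearIdeal f c = ⊤ ↔ bFunction f ∣ c := by
  rw [Ideal.eq_top_iff_one, mem_clearIdeal, bFunction_dvd_iff (FractionRing A) hf, map_one, C_1,
    one_mul]

section Away

variable {h : A} (A' : Type*) [CommRing A'] [Algebra ℂ A'] [Algebra A A'] [IsScalarTower ℂ A A']
  [IsLocalization.Away h A']

/-- Realizes the localization as a subalgebra of the field of fractions of `A`, so that both
b-functions are tested in one space. -/
theorem exists_localization_range (h0 : h ≠ 0) (hf : f ≠ 0) : ∃ S' : Subalgebra ℂ (FractionRing A),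
    (IsScalarTower.toAlgHom ℂ A (FractionRing A)).range ≤ S' ∧
    (algebraMap A (FractionRing A) h)⁻¹ ∈ S' ∧
    (∀ a ∈ S', ∃ N : ℕ, algebraMap A (FractionRing A) h ^ N * a ∈
      (IsScalarTower.toAlgHom ℂ A (FractionRing A)).range) ∧
    ∀ c : ℂ[X], bFunction (algebraMap A A' f) ∣ c ↔ c.map (algebraMap ℂ (FractionRing A)) ∈
      dMod S' (algebraMap A _ f) := by
  let K := FractionRing A
  have hh : algebraMap A K h ≠ 0 := by rwa [Ne, IsFractionRing.to_map_eq_zero_iff]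
  have hdom : IsDomain A' := IsLocalization.isDomain_of_le_nonZeroDivisors (M := .powers h) A'
    (powers_le_nonZeroDivisors_of_noZeroDivisors h0)
  let _ : Algebra A' K := (IsLocalization.Away.lift (S := A') h (IsUnit.mk0 _ hh)).toAlgebra
  have hl : ∀ a, algebraMap A' K (algebraMap A A' a) = algebraMap A K a := fun a =>
    IsLocalization.Away.lift_eq h (IsUnit.mk0 _ hh) a
  have ht : IsScalarTower A A' K := IsScalarTower.of_algebraMap_eq fun a => (hl a).symm
  have ht' : IsScalarTower ℂ A' K := IsScalarTower.of_algebraMap_eq fun r => by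
    rw [IsScalarTower.algebraMap_apply ℂ A A', hl, ← IsScalarTower.algebraMap_apply]
  have hfrac : IsFractionRing A' K := IsFractionRing.isFractionRing_of_isDomain_of_isLocalization
    (.powers h) A' K
  have hf' : algebraMap A A' f ≠ 0 := by
    intro h'
    have := hl f
    rw [h', map_zero, eq_comm, IsFractionRing.to_map_eq_zero_iff] at this
    exact hf this
  refine ⟨(IsScalarTower.toAlgHom ℂ A' K).range, ?_, ?_, ?_, fun c => ?_⟩
  · rintro _ ⟨a, rfl⟩
    exact ⟨algebraMap A A' a, hl a⟩
  · refine ⟨IsLocalization.Away.invSelf h, eq_inv_of_mul_eq_one_left ?_⟩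
    change algebraMap A' K _ * _ = 1
    rw [← hl, ← map_mul, mul_comm, IsLocalization.Away.mul_invSelf, map_one]
  · rintro _ ⟨b, rfl⟩
    obtain ⟨⟨a, ⟨t, n, hn⟩⟩, h⟩ := IsLocalization.surj (Submonoid.powers h) b
    refine ⟨n, a, ?_⟩
    change algebraMap A K a = _ * algebraMap A' K b
    simp only at hn h
    rw [← hl a, ← h, map_mul, hl, ← hn, map_pow, mul_comm]
  · rw [bFunction_dvd_iff K hf', hl]

theorem bFunction_away_dvd (h0 : h ≠ 0) (hf : f ≠ 0) {c : ℂ[X]} (hc : bFunction f ∣ c) :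
    bFunction (algebraMap A A' f) ∣ c := by
  obtain ⟨S', h1, h2, h3, h4⟩ := exists_localization_range A' h0 hf
  rw [bFunction_dvd_iff (FractionRing A) hf] at hc
  exact (h4 c).2 (dMod_le_of_localization h1 h2 ⟨h, rfl⟩ (by simpa using h0) h3 hc)

/-- What a divisibility on the open set `h ≠ 0` leaves on the whole space. Local-to-global arguments
collect such powers in `clearIdeal`. -/
theorem exists_pow_mem_clearIdeal [Algebra.FiniteType ℂ A] (h0 : h ≠ 0) (hf : f ≠ 0) {c : ℂ[X]}
    (hc : bFunction (algebraMap A A' f) ∣ c) : ∃ N : ℕ, h ^ N ∈ clearIdeal f c := by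
  obtain ⟨S', h1, -, h3, h4⟩ := exists_localization_range A' h0 hf
  have hfg : (IsScalarTower.toAlgHom ℂ A (FractionRing A)).range.FG := by
    rw [← Algebra.map_top]
    exact Subalgebra.FG.map _ Algebra.FiniteType.out
  obtain ⟨N, hN⟩ := exists_pow_mul_mem_dMod hfg h1 (AlgHom.mem_range_self _ h) h3 ((h4 c).1 hc)
  exact ⟨N, by rwa [mem_clearIdeal, map_pow]⟩

end Away

end Intrinsic


/-! ### Polynomial rings: partial derivatives and the grading by one variable. -/

theorem derivation_eq_zero_of_fractionRing {A K : Type*} [CommRing A] [IsDomain A] [Algebra ℂ A]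
    [Field K] [Algebra ℂ K] [Algebra A K] [IsFractionRing A K] (D : Derivation ℂ K K)
    (h : ∀ a, D (algebraMap A K a) = 0) : D = 0 := by
  ext x
  obtain ⟨a, b, -, rfl⟩ := IsFractionRing.div_surjective (A := A) x
  rw [Derivation.leibniz_div, h, h]
  simp

theorem derivation_sum_apply {ι A : Type*} [CommRing A] [Algebra ℂ A] (s : Finset ι)
    (d : ι → Derivation ℂ A A) (x : A) : (∑ l ∈ s, d l) x = ∑ l ∈ s, d l x := by
  classical
  induction s using Finset.induction_on with
  | empty => simp
  | insert a s ha ih => rw [Finset.sum_insert ha, Finset.sum_insert ha, Derivation.add_apply, ih]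

theorem mem_of_mem_iSup_eigenspace {V : Type*} [AddCommGroup V] [Module ℂ V] (θ : Module.End ℂ V)
    (T : ℤ → Submodule ℂ V) (hT : ∀ k, T k ≤ θ.eigenspace (k : ℂ)) {x : V} (hx : x ∈ ⨆ k, T k)
    (hx0 : θ x = 0) : x ∈ T 0 := by
  rw [iSup_split_single T 0] at hx
  obtain ⟨y, hy, z, hz, rfl⟩ := Submodule.mem_sup.1 hx
  have hind : iSupIndep fun k : ℤ => θ.eigenspace (k : ℂ) :=
    θ.eigenspaces_iSupIndep.comp Int.cast_injective
  have hz0 : z ∈ θ.eigenspace ((0 : ℤ) : ℂ) := by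
    have hy0 := hT 0 hy
    rw [Module.End.mem_eigenspace_iff] at hy0 ⊢
    rw [map_add, hy0] at hx0
    simpa using hx0
  have hz1 : z ∈ ⨆ (k : ℤ) (_ : k ≠ 0), θ.eigenspace (k : ℂ) :=
    iSup₂_mono (fun k _ => hT k) hz
  rw [Submodule.disjoint_def.1 (hind 0) z hz0 hz1, add_zero]
  exact hy

section Polynomial

variable {σ : Type} {n : ℕ}

/-- The field of rational functions. -/
abbrev MvRat (σ : Type) : Type := FractionRing (MvPolynomial σ ℂ)

/-- The polynomial functions as a subalgebra of the field of rational functions. -/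
noncomputable abbrev polySub (σ : Type) : Subalgebra ℂ (MvRat σ) :=
  (IsScalarTower.toAlgHom ℂ (MvPolynomial σ ℂ) (MvRat σ)).range

/-- The embedding of the polynomials in the field of rational functions. -/
noncomputable abbrev ratMap (σ : Type) : MvPolynomial σ ℂ →+* MvRat σ :=
  algebraMap (MvPolynomial σ ℂ) (MvRat σ)

theorem ratMap_mem (p : MvPolynomial σ ℂ) : ratMap σ p ∈ polySub σ := AlgHom.mem_range_self _ p

/-- The partial derivatives of rational functions. -/
noncomputable def ratPderiv (l : σ) : Derivation ℂ (MvRat σ) (MvRat σ) :=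
  (exists_derivation_extend (K := MvRat σ) (MvPolynomial.pderiv (R := ℂ) l)).choose

theorem ratPderiv_ratMap (l : σ) (p : MvPolynomial σ ℂ) :
    ratPderiv l (ratMap σ p) = ratMap σ (MvPolynomial.pderiv l p) :=
  (exists_derivation_extend (K := MvRat σ) (MvPolynomial.pderiv (R := ℂ) l)).choose_spec p

theorem ratPderiv_mem (l : σ) {a : MvRat σ} (ha : a ∈ polySub σ) :
    ratPderiv l a ∈ polySub σ := by
  obtain ⟨p, rfl⟩ := ha
  exact ratPderiv_ratMap l p ▸ ratMap_mem _

theorem ratPderiv_X [DecidableEq σ] (l k : σ) :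
    ratPderiv l (ratMap σ (MvPolynomial.X k)) = if l = k then 1 else 0 := by
  rw [ratPderiv_ratMap, MvPolynomial.pderiv_X, Pi.single_apply]
  split_ifs with h h' h' <;> simp_all

theorem derivation_ext_X {δ δ' : Derivation ℂ (MvRat σ) (MvRat σ)}
    (h : ∀ l, δ (ratMap σ (MvPolynomial.X l)) = δ' (ratMap σ (MvPolynomial.X l))) : δ = δ' := by
  rw [← sub_eq_zero]
  refine derivation_eq_zero_of_fractionRing (A := MvPolynomial σ ℂ) _ fun p => ?_
  induction p using MvPolynomial.induction_on with
  | C a =>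
    rw [← MvPolynomial.algebraMap_eq, ← IsScalarTower.algebraMap_apply, Derivation.map_algebraMap]
  | add p q hp hq => rw [map_add, map_add, hp, hq, add_zero]
  | mul_X p l hp =>
    rw [map_mul, Derivation.leibniz, hp, Derivation.sub_apply, h, sub_self, smul_zero, smul_zero,
      add_zero]

theorem derivation_eq_sum [Fintype σ] (δ : Derivation ℂ (MvRat σ) (MvRat σ)) :
    δ = ∑ l, δ (ratMap σ (MvPolynomial.X l)) • ratPderiv l := by
  classical
  refine derivation_ext_X fun k => ?_
  simp [derivation_sum_apply, ratPderiv_X]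

theorem ratPderiv_comm (l k : σ) (x : MvRat σ) :
    ratPderiv l (ratPderiv k x) = ratPderiv k (ratPderiv l x) := by
  classical
  have : ⁅ratPderiv l, ratPderiv k⁆ = 0 := by
    refine derivation_ext_X fun j => ?_
    rw [Derivation.commutator_apply, ratPderiv_X, ratPderiv_X]
    split_ifs <;> simp
  rw [← sub_eq_zero, ← Derivation.commutator_apply, this, Derivation.zero_apply]

/-- `nabla` as a linear map. -/
noncomputable def nablaLin {K : Type*} [Field K] [Algebra ℂ K] (f : K) (δ : Derivation ℂ K K) :
    Module.End ℂ K[X] := coeffDer δ + LinearMap.mulLeft ℂ (X * C (δ f / f))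

/-- Stability need only be tested on coordinates and partial derivatives, since every derivation is
a combination of the latter. -/
theorem dMod_le_of_pderiv [Fintype σ] {f : MvRat σ} {W : Submodule ℂ (MvRat σ)[X]}
    (hX : ∀ m ∈ W, X * m ∈ W) (hC : ∀ l, ∀ m ∈ W, C (ratMap σ (MvPolynomial.X l)) * m ∈ W)
    (hd : ∀ l, ∀ m ∈ W, nabla f (ratPderiv l) m ∈ W) (hf : C f ∈ W) :
    dMod (polySub σ) f ≤ W := by
  have hC' : ∀ a ∈ polySub σ, ∀ m ∈ W, C a * m ∈ W := by
    rintro _ ⟨p, rfl⟩ m hm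
    change C (ratMap σ p) * m ∈ W
    induction p using MvPolynomial.induction_on generalizing m with
    | C a =>
      rw [← MvPolynomial.algebraMap_eq, ← IsScalarTower.algebraMap_apply, ← algebraMap_eq,
        ← Algebra.smul_def, algebraMap_smul]
      exact Submodule.smul_mem _ _ hm
    | add p q hp hq =>
      rw [map_add, C_add, add_mul]
      exact add_mem (hp m hm) (hq m hm)
    | mul_X p l hp =>
      rw [map_mul, C_mul, mul_assoc]
      exact hp _ (hC l m hm)
  refine dMod_le ⟨hX, hC', fun δ hδ m hm => ?_⟩ hf
  rw [derivation_eq_sum δ, nabla_sum_der]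
  refine Submodule.sum_mem _ fun l _ => ?_
  rw [nabla_smul_der]
  exact hC' _ (hδ _ (ratMap_mem _)) _ (hd l m hm)

section Graded

variable [Fintype σ] (i : σ) {g : MvRat σ} (e : ℕ) (N : Submodule ℂ (MvRat σ)[X])
  (ρ : ℤ → ℂ[X])

/-- Put `u = X i` and `T k = u^k ρ_k(s) N`. The sum of the `T k` is stable under the operators
acting through `(u^e g)^s`: multiplication by `u` maps `T k` to `T (k + 1)` because `ρ (k + 1) ∣ ρ
k`, and `∂_u` produces the factor `e s + k`, so it maps `T k` to `T (k - 1)` because `ρ (k - 1) ∣ (e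
s + k) ρ k`. As `c(s)` has degree `0` in `u`, it must lie in `T 0`. -/
theorem exists_of_mem_dMod_pow_mul (hg : g ≠ 0) (hgi : ratPderiv i g = 0)
    (hNi : ∀ m ∈ N, coeffDer (ratPderiv i) m = 0)
    (hX : ∀ m ∈ N, X * m ∈ N)
    (hC : ∀ l ≠ i, ∀ m ∈ N, C (ratMap σ (MvPolynomial.X l)) * m ∈ N)
    (hd : ∀ l ≠ i, ∀ m ∈ N, nabla g (ratPderiv l) m ∈ N) (hgN : C g ∈ N)
    (hρ : ∀ k, ∃ q, ρ k = ρ (k + 1) * q)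
    (hρ' : ∀ k : ℤ, ∃ q, (C (e : ℂ) * X + C (k : ℂ)) * ρ k = ρ (k - 1) * q) (hρe : ρ e = 1)
    {c : ℂ[X]} (hc : c.map (algebraMap ℂ (MvRat σ)) ∈
      dMod (polySub σ) (ratMap σ (MvPolynomial.X i) ^ e * g)) :
    ∃ m ∈ N, c.map (algebraMap ℂ (MvRat σ)) = (ρ 0).map (algebraMap ℂ (MvRat σ)) * m := by
  classical
  set u := ratMap σ (MvPolynomial.X i) with hu
  have hu0 : u ≠ 0 := by simp [hu, MvPolynomial.X_ne_zero]
  have hui : ratPderiv i u = 1 := by rw [hu, ratPderiv_X, if_pos rfl]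
  have hul : ∀ l ≠ i, ratPderiv l u = 0 := fun l hl => by rw [hu, ratPderiv_X, if_neg hl]
  have huk : ∀ k : ℤ, ratPderiv i (u ^ k) = k * u ^ (k - 1) := fun k => by
    rw [Derivation.leibniz_zpow, hui]; simp
  have hulk : ∀ l ≠ i, ∀ k : ℤ, ratPderiv l (u ^ k) = 0 := fun l hl k => by
    rw [Derivation.leibniz_zpow, hul l hl]; simp
  let T : ℤ → Submodule ℂ (MvRat σ)[X] := fun k =>
    N.map (LinearMap.mulLeft ℂ (C (u ^ k) * (ρ k).map (algebraMap ℂ (MvRat σ))))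
  have hTmem : ∀ k, ∀ m ∈ N, C (u ^ k) * (ρ k).map (algebraMap ℂ (MvRat σ)) * m ∈ T k :=
    fun k m hm => ⟨m, hm, rfl⟩
  have hNmap : ∀ q : ℂ[X], ∀ m ∈ N, q.map (algebraMap ℂ (MvRat σ)) * m ∈ N :=
    fun q m hm => map_mul_mem_of_X_mul hX q hm
  have hTN : ∀ (k : ℤ) (L : Module.End ℂ (MvRat σ)[X]) (k' : ℤ),
      (∀ m ∈ N, L (C (u ^ k) * (ρ k).map (algebraMap ℂ (MvRat σ)) * m) ∈ T k') →
      T k ≤ (⨆ k, T k).comap L := by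
    rintro k L k' h _ ⟨m, hm, rfl⟩
    exact Submodule.mem_iSup_of_mem k' (h m hm)
  have hle : dMod (polySub σ) (u ^ e * g) ≤ ⨆ k, T k := by
    refine dMod_le_of_pderiv ?_ ?_ ?_ ?_
    · have : (⨆ k, T k) ≤ (⨆ k, T k).comap (LinearMap.mulLeft ℂ X) := iSup_le fun k =>
        hTN k _ k fun m hm => by
          rw [LinearMap.mulLeft_apply, mul_left_comm]
          exact hTmem k _ (hX m hm)
      exact this
    · intro l
      have : (⨆ k, T k) ≤ (⨆ k, T k).comap
          (LinearMap.mulLeft ℂ (C (ratMap σ (MvPolynomial.X l)))) := by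
        by_cases hl : l = i
        · subst hl
          refine iSup_le fun k => hTN k _ (k + 1) fun m hm => ?_
          obtain ⟨q, hq⟩ := hρ k
          have : LinearMap.mulLeft ℂ (C u) (C (u ^ k) *
              (ρ k).map (algebraMap ℂ (MvRat σ)) * m) = C (u ^ (k + 1)) *
              (ρ (k + 1)).map (algebraMap ℂ (MvRat σ)) *
              (q.map (algebraMap ℂ (MvRat σ)) * m) := by
            rw [LinearMap.mulLeft_apply, hq, Polynomial.map_mul, zpow_add_one₀ hu0, C_mul]
            ring
          rw [this]
          exact hTmem _ _ (hNmap q m hm)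
        · refine iSup_le fun k => hTN k _ k fun m hm => ?_
          rw [LinearMap.mulLeft_apply, mul_left_comm]
          exact hTmem k _ (hC l hl m hm)
      exact this
    · intro l
      have : (⨆ k, T k) ≤ (⨆ k, T k).comap (nablaLin (u ^ e * g) (ratPderiv l)) := by
        by_cases hl : l = i
        · subst hl
          refine iSup_le fun k => hTN k _ (k - 1) fun m hm => ?_
          obtain ⟨q, hq⟩ := hρ' k
          have hdiv : ratPderiv l (u ^ e * g) / (u ^ e * g) = e * u⁻¹ := by
            rw [Derivation.leibniz, hgi, smul_zero, zero_add, ← zpow_natCast u e, huk, smul_eq_mul,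
              zpow_sub_one₀ hu0]
            field_simp
            simp
          have : nablaLin (u ^ e * g) (ratPderiv l) (C (u ^ k) *
              (ρ k).map (algebraMap ℂ (MvRat σ)) * m) = C (u ^ (k - 1)) *
              ((C (e : ℂ) * X + C (k : ℂ)) * ρ k).map (algebraMap ℂ (MvRat σ)) * m := by
            change nabla _ _ _ = _
            rw [mul_assoc, nabla_C_mul, nabla_map_mul, nabla, hNi m hm, hdiv, huk,
              zpow_sub_one₀ hu0]
            simp only [Polynomial.map_mul, Polynomial.map_add, map_X, C_mul, map_natCast,
              map_intCast, Polynomial.map_natCast, Polynomial.map_intCast]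
            ring
          rw [this, hq, Polynomial.map_mul]
          have h2 := hTmem (k - 1) _ (hNmap q m hm)
          rw [← mul_assoc] at h2 ⊢
          exact h2
        · refine iSup_le fun k => hTN k _ k fun m hm => ?_
          have hdiv : ratPderiv l (u ^ e * g) / (u ^ e * g) = ratPderiv l g / g := by
            rw [Derivation.leibniz, ← zpow_natCast u e, hulk l hl, smul_zero, add_zero, smul_eq_mul]
            have := zpow_ne_zero (e : ℤ) hu0
            field_simp
          have : nablaLin (u ^ e * g) (ratPderiv l) (C (u ^ k) *
              (ρ k).map (algebraMap ℂ (MvRat σ)) * m) = C (u ^ k) *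
              (ρ k).map (algebraMap ℂ (MvRat σ)) * nabla g (ratPderiv l) m := by
            change nabla _ _ _ = _
            rw [mul_assoc, nabla_C_mul, nabla_map_mul, hulk l hl, nabla, hdiv, C_0, zero_mul,
              zero_add, nabla]
            ring
          rw [this]
          exact hTmem _ _ (hd l hl m hm)
      exact this
    · refine Submodule.mem_iSup_of_mem (e : ℤ) ⟨C g, hgN, ?_⟩
      rw [hρe, LinearMap.mulLeft_apply, zpow_natCast, Polynomial.map_one, mul_one, C_mul]
  -- The grading operator is `u ∂_u` on the coefficients alone, without the twist by `f^s`; it has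
  -- eigenvalue `k` on `T k` and kills `c(s)`.
  have hT : ∀ k, T k ≤ Module.End.eigenspace (coeffDer (u • ratPderiv i)) (k : ℂ) := by
    rintro k _ ⟨m, hm, rfl⟩
    have huk' : u * ((k : MvRat σ) * (u ^ k * u⁻¹)) = k * u ^ k := by field_simp
    rw [Module.End.mem_eigenspace_iff, LinearMap.mulLeft_apply, mul_assoc, coeffDer_C_mul,
      coeffDer_map_mul, coeffDer_smul_der, hNi m hm, Derivation.smul_apply, huk, mul_zero, mul_zero,
      mul_zero, add_zero, smul_eq_mul, zpow_sub_one₀ hu0, huk', C_mul, mul_assoc, Algebra.smul_def,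
      IsScalarTower.algebraMap_apply ℂ (MvRat σ) (MvRat σ)[X], map_intCast, map_intCast,
      map_intCast]
  have h0 := mem_of_mem_iSup_eigenspace _ T hT (hle hc) (coeffDer_map _ c)
  obtain ⟨m, hm, h⟩ := h0
  refine ⟨m, hm, ?_⟩
  rw [← h, LinearMap.mulLeft_apply, zpow_zero, C_1, one_mul]

end Graded

end Polynomial


/-! ### Multiplication by a power of an independent variable. -/

section PowMul

variable {σ : Type}

theorem coeffDer_ratPderiv_comm (l k : σ) (m : (MvRat σ)[X]) :
    coeffDer (ratPderiv l) (coeffDer (ratPderiv k) m) =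
      coeffDer (ratPderiv k) (coeffDer (ratPderiv l) m) := by
  ext j
  simp only [coeff_coeffDer]
  exact ratPderiv_comm l k _

theorem coeffDer_nabla_eq_zero {i : σ} {g : MvRat σ} (hgi : ratPderiv i g = 0) (l : σ)
    {m : (MvRat σ)[X]} (hm : coeffDer (ratPderiv i) m = 0) :
    coeffDer (ratPderiv i) (nabla g (ratPderiv l) m) = 0 := by
  have h : ratPderiv i (ratPderiv l g / g) = 0 := by
    rw [Derivation.leibniz_div_const _ _ _ hgi, ratPderiv_comm, hgi, map_zero, smul_zero]
  rw [nabla, map_add, coeffDer_ratPderiv_comm, hm, map_zero, mul_assoc, coeffDer_X_mul,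
    coeffDer_C_mul, h, hm]
  simp

/-- `∏_{i = 1}^d (d s + i)`. -/
noncomputable def powPoly (d : ℕ) : ℂ[X] := ∏ t ∈ Finset.Icc 1 d, (C (d : ℂ) * X + C (t : ℂ))

theorem powPoly_ne_zero (d : ℕ) : powPoly d ≠ 0 := by
  refine Finset.prod_ne_zero_iff.2 fun t ht h => ?_
  have := congrArg (eval 0) h
  rw [Finset.mem_Icc] at ht
  simp at this
  omega

variable {i : σ} {d : ℕ} {g : MvPolynomial σ ℂ}

/-- With `F = u^d g`, `∂_u (u^(k+1) g F^s) = (d s + k + 1) u^k g F^s`; differentiating `d` times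
from `u^d g F^s = F^(s+1)` gives all the factors. -/
theorem powPoly_mul_mem (hg : g ≠ 0) (hgi : MvPolynomial.pderiv i g = 0) :
    (powPoly d).map (algebraMap ℂ (MvRat σ)) * C (ratMap σ g) ∈
      dMod (polySub σ) (ratMap σ (MvPolynomial.X i ^ d * g)) := by
  classical
  have hg' : ratMap σ g ≠ 0 := by rwa [Ne, IsFractionRing.to_map_eq_zero_iff]
  have hgi' : ratPderiv i (ratMap σ g) = 0 := by rw [ratPderiv_ratMap, hgi, map_zero]
  have hst := dMod_stable (polySub σ) (ratMap σ (MvPolynomial.X i ^ d * g))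
  set u := ratMap σ (MvPolynomial.X i) with hu
  have hu0 : u ≠ 0 := by simp [hu, MvPolynomial.X_ne_zero]
  have hui : ratPderiv i u = 1 := by rw [hu, ratPderiv_X, if_pos rfl]
  have key : ∀ j ≤ d, (∏ t ∈ Finset.Icc (d - j + 1) d, (C (d : ℂ) * X + C (t : ℂ))).map
      (algebraMap ℂ (MvRat σ)) * C (u ^ (d - j) * ratMap σ g) ∈
        dMod (polySub σ) (ratMap σ (MvPolynomial.X i ^ d * g)) := by
    intro j hj
    induction j with
    | zero =>
      have := gen_mem_dMod (polySub σ) (ratMap σ (MvPolynomial.X i ^ d * g))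
      simpa using this
    | succ j ih =>
      have h := hst.nabla _ (fun a => ratPderiv_mem i) _ (ih (by omega))
      obtain ⟨k, hk⟩ : ∃ k, d - j = k + 1 := ⟨d - j - 1, by omega⟩
      have hk' : d - (j + 1) = k := by omega
      have hlog : ratPderiv i (ratMap σ (MvPolynomial.X i ^ d * g)) /
          ratMap σ (MvPolynomial.X i ^ d * g) = d * u⁻¹ := by
        rw [map_mul, map_pow, Derivation.leibniz, hgi', smul_zero, zero_add, Derivation.leibniz_pow,
          hui, smul_eq_mul, ← hu]
        rcases d with _ | d
        · simp
        · simp only [pow_succ, Nat.add_sub_cancel, nsmul_eq_mul, smul_eq_mul, mul_one]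
          field_simp
      have hmul : nabla (ratMap σ (MvPolynomial.X i ^ d * g)) (ratPderiv i)
          (C (u ^ (k + 1) * ratMap σ g)) =
          (C (d : ℂ) * X + C ((k + 1 : ℕ) : ℂ)).map (algebraMap ℂ (MvRat σ)) *
            C (u ^ k * ratMap σ g) := by
        have h1 : (d : MvRat σ) * u⁻¹ * (u ^ (k + 1) * ratMap σ g) = d * (u ^ k * ratMap σ g) := by
          field_simp
          ring
        have h2 : ratPderiv i (u ^ (k + 1) * ratMap σ g) =
            ((k + 1 : ℕ) : MvRat σ) * (u ^ k * ratMap σ g) := by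
          rw [Derivation.leibniz, hgi', smul_zero, zero_add, Derivation.leibniz_pow, hui]
          simp
          ring
        rw [nabla, hlog, coeffDer_C, h2, mul_assoc, ← C_mul, h1]
        simp only [Polynomial.map_mul, Polynomial.map_add, map_X, C_mul, map_natCast,
              Polynomial.map_natCast]
        ring
      rw [nabla_map_mul, hk, hmul, ← mul_assoc, ← Polynomial.map_mul] at h
      rw [hk', ← Finset.insert_Icc_add_one_left_eq_Icc (by omega), Finset.prod_insert (by simp),
        mul_comm (_ + _)]
      exact h
  have := key d le_rfl
  simpa [powPoly] using this

variable [Fintype σ]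

theorem exists_of_bFunction_pow_mul_dvd (hg : g ≠ 0) (hgi : MvPolynomial.pderiv i g = 0) {c : ℂ[X]}
    (hc : bFunction (MvPolynomial.X i ^ d * g) ∣ c) :
    ∃ c', c = powPoly d * c' ∧ bFunction g ∣ c' := by
  have hg' : ratMap σ g ≠ 0 := by rwa [Ne, IsFractionRing.to_map_eq_zero_iff]
  have hgi' : ratPderiv i (ratMap σ g) = 0 := by rw [ratPderiv_ratMap, hgi, map_zero]
  have hX : (MvPolynomial.X i : MvPolynomial σ ℂ) ≠ 0 := MvPolynomial.X_ne_zero i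
  rw [bFunction_dvd_iff (MvRat σ) (mul_ne_zero (pow_ne_zero _ hX) hg), map_mul, map_pow] at hc
  -- Lowering the exponent of `u` from `d` to `k` costs the factors `d s + t` with `k < t`; for
  -- negative `k` there are no further ones.
  let ρ : ℤ → ℂ[X] := fun k => ∏ t ∈ (Finset.Icc 1 d).filter fun t : ℕ => k < t,
    (C (d : ℂ) * X + C (t : ℂ))
  have hst := dMod_stable (polySub σ) (ratMap σ g)
  refine Exists.elim (exists_of_mem_dMod_pow_mul i d
    (dMod (polySub σ) (ratMap σ g) ⊓ LinearMap.ker (coeffDer (ratPderiv i))) ρ hg' hgi'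
    (fun m hm => hm.2) ?_ ?_ ?_ ?_ ?_ ?_ ?_ hc) ?_
  · intro m hm
    refine ⟨hst.X_mul _ hm.1, ?_⟩
    change coeffDer _ _ = 0
    rw [coeffDer_X_mul, show coeffDer _ m = 0 from hm.2, mul_zero]
  · classical
    intro l hl m hm
    refine ⟨hst.C_mul _ (ratMap_mem _) _ hm.1, ?_⟩
    change coeffDer _ _ = 0
    rw [coeffDer_C_mul, show coeffDer _ m = 0 from hm.2, ratPderiv_X, if_neg hl.symm]
    simp
  · exact fun l _ m hm => ⟨hst.nabla _ (fun a => ratPderiv_mem l) _ hm.1,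
      coeffDer_nabla_eq_zero hgi' l hm.2⟩
  · refine ⟨gen_mem_dMod _ _, ?_⟩
    change coeffDer _ _ = 0
    rw [coeffDer_C, hgi', C_0]
  · intro k
    exact Finset.prod_dvd_prod_of_subset _ _ _ (Finset.monotone_filter_right _ fun t _ ht =>
      (lt_add_one k).trans ht)
  · intro k
    change ρ (k - 1) ∣ (C (d : ℂ) * X + C (k : ℂ)) * ρ k
    by_cases hk : 1 ≤ k ∧ k ≤ d
    · lift k to ℕ using by omega
      refine dvd_of_eq ?_
      have : (Finset.Icc 1 d).filter (fun t : ℕ => (k : ℤ) - 1 < t) =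
          insert k ((Finset.Icc 1 d).filter fun t : ℕ => (k : ℤ) < t) := by
        ext t
        simp only [Finset.mem_filter, Finset.mem_Icc, Finset.mem_insert]
        omega
      change ∏ t ∈ _, _ = _ * ∏ t ∈ _, _
      rw [this, Finset.prod_insert (by simp)]
      simp
    · refine Dvd.dvd.mul_left (Finset.prod_dvd_prod_of_subset _ _ _ fun t => ?_) _
      simp only [Finset.mem_filter, Finset.mem_Icc]
      omega
  · refine Finset.prod_eq_one fun t ht => ?_
    simp only [Finset.mem_filter, Finset.mem_Icc] at ht
    omega
  · rintro m ⟨hm, h⟩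
    have hρ0 : ρ 0 = powPoly d := by
      refine Finset.prod_congr (Finset.filter_true_of_mem fun t ht => ?_) fun _ _ => rfl
      rw [Finset.mem_Icc] at ht
      exact_mod_cast ht.1
    rw [hρ0] at h
    -- Divisibility over the field of rational functions descends to `ℂ`.
    obtain ⟨c', rfl⟩ := (Polynomial.map_dvd_map' (algebraMap ℂ (MvRat σ))).1 ⟨m, h⟩
    refine ⟨c', rfl, ?_⟩
    rw [Polynomial.map_mul] at h
    have hr : (powPoly d).map (algebraMap ℂ (MvRat σ)) ≠ 0 := by
      rw [Ne, Polynomial.map_eq_zero]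
      exact powPoly_ne_zero d
    rw [bFunction_dvd_iff (MvRat σ) hg, mul_left_cancel₀ hr h]
    exact hm.1

/-- For `l ≠ i` the logarithmic derivatives of `F = u^d g` and `g` along `l` agree, so operators not
involving `x_i` act alike for both and carry `powPoly d * g` to further elements of the module of
`F`. The graded lemma with exponent `0` and `ρ` the indicator of `k ≥ 0` shows that such operators
suffice to reach `c(s)`. -/
theorem bFunction_pow_mul_dvd (hg : g ≠ 0) (hgi : MvPolynomial.pderiv i g = 0) {c : ℂ[X]}
    (hc : bFunction g ∣ c) : bFunction (MvPolynomial.X i ^ d * g) ∣ powPoly d * c := by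
  have hg' : ratMap σ g ≠ 0 := by rwa [Ne, IsFractionRing.to_map_eq_zero_iff]
  have hgi' : ratPderiv i (ratMap σ g) = 0 := by rw [ratPderiv_ratMap, hgi, map_zero]
  have hX : (MvPolynomial.X i : MvPolynomial σ ℂ) ≠ 0 := MvPolynomial.X_ne_zero i
  rw [bFunction_dvd_iff (MvRat σ) (mul_ne_zero (pow_ne_zero _ hX) hg)]
  rw [bFunction_dvd_iff (MvRat σ) hg] at hc
  have hst := dMod_stable (polySub σ) (ratMap σ (MvPolynomial.X i ^ d * g))
  set F := ratMap σ (MvPolynomial.X i ^ d * g) with hF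
  set r := (powPoly d).map (algebraMap ℂ (MvRat σ)) with hr
  refine Exists.elim (exists_of_mem_dMod_pow_mul (c := c) i 0
    ((dMod (polySub σ) F).comap (LinearMap.mulLeft ℂ r) ⊓
      LinearMap.ker (coeffDer (ratPderiv i))) (fun k => if 0 ≤ k then 1 else 0) hg' hgi'
    (fun m hm => hm.2) ?_ ?_ ?_ ?_ ?_ ?_ ?_ (by rwa [pow_zero, one_mul])) ?_
  · intro m hm
    refine ⟨?_, ?_⟩
    · have hm1 : r * m ∈ dMod (polySub σ) F := hm.1
      have := hst.X_mul _ hm1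
      rwa [mul_left_comm] at this
    change coeffDer _ _ = 0
    rw [coeffDer_X_mul, show coeffDer _ m = 0 from hm.2, mul_zero]
  · classical
    intro l hl m hm
    refine ⟨?_, ?_⟩
    · have hm1 : r * m ∈ dMod (polySub σ) F := hm.1
      have := hst.C_mul _ (ratMap_mem (MvPolynomial.X l)) _ hm1
      rwa [mul_left_comm] at this
    change coeffDer _ _ = 0
    rw [coeffDer_C_mul, show coeffDer _ m = 0 from hm.2, ratPderiv_X, if_neg hl.symm]
    simp
  · classical
    intro l hl m hm
    refine ⟨?_, coeffDer_nabla_eq_zero hgi' l hm.2⟩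
    have hm1 : r * m ∈ dMod (polySub σ) F := hm.1
    have hdiv : ratPderiv l F / F = ratPderiv l (ratMap σ g) / ratMap σ g := by
      have hu0 : ratMap σ (MvPolynomial.X i) ≠ 0 := by simp [MvPolynomial.X_ne_zero]
      rw [hF, map_mul, map_pow, Derivation.leibniz, Derivation.leibniz_pow, ratPderiv_X,
        if_neg hl]
      simp only [smul_eq_mul, mul_zero, smul_zero, add_zero]
      field_simp
    have := hst.nabla _ (fun a => ratPderiv_mem l) _ hm1
    rw [hr, nabla_map_mul, nabla, hdiv] at this
    exact this
  · refine ⟨powPoly_mul_mem hg hgi, ?_⟩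
    change coeffDer _ _ = 0
    rw [coeffDer_C, hgi', C_0]
  · intro k
    by_cases hk : 0 ≤ k
    · exact ⟨1, by simp [hk, hk.trans (lt_add_one k).le]⟩
    · exact ⟨0, by simp [hk]⟩
  · intro k
    change (if 0 ≤ k - 1 then 1 else 0 : ℂ[X]) ∣
      (C ((0 : ℕ) : ℂ) * X + C (k : ℂ)) * if 0 ≤ k then 1 else 0
    by_cases hk : 0 < k
    · rw [if_pos (by omega : 0 ≤ k - 1)]
      exact one_dvd _
    · by_cases hk' : k = 0
      · simp [hk']
      · rw [if_neg (by omega : ¬ 0 ≤ k), mul_zero]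
        exact dvd_zero _
  · simp
  · rintro m ⟨hm, h⟩
    rw [if_pos le_rfl, Polynomial.map_one, one_mul] at h
    rw [Polynomial.map_mul, h]
    exact hm.1

end PowMul


/-! ### Euler fields and quasi-homogeneous functions. -/

section Euler

/-- Applying `θ - (D + 1)` removes the top eigenvector and rescales `p 0` by a nonzero number. -/
theorem mem_of_sum_eigenvectors_mem {V : Type*} [AddCommGroup V] [Module ℂ V] (θ : Module.End ℂ V)
    {W : Submodule ℂ V} (hW : ∀ x ∈ W, θ x ∈ W) (D : ℕ) {p : ℕ → V}
    (hp : ∀ t, θ (p t) = (t : ℂ) • p t) (hsum : ∑ t ∈ Finset.range (D + 1), p t ∈ W) :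
    p 0 ∈ W := by
  induction D generalizing p with
  | zero => simpa using hsum
  | succ D ih =>
    have h1 : ∑ t ∈ Finset.range (D + 1), ((t : ℂ) - ((D + 1 : ℕ) : ℂ)) • p t ∈ W := by
      have h2 := sub_mem (hW _ hsum) (W.smul_mem ((D + 1 : ℕ) : ℂ) hsum)
      rw [map_sum, Finset.smul_sum, ← Finset.sum_sub_distrib, Finset.sum_range_succ] at h2
      simpa only [hp, sub_self, add_zero, sub_smul] using h2
    have h3 := ih (p := fun t => ((t : ℂ) - ((D + 1 : ℕ) : ℂ)) • p t)
      (fun t => by rw [map_smul, hp, smul_comm]) h1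
    have h4 : ((0 : ℕ) : ℂ) - ((D + 1 : ℕ) : ℂ) ≠ 0 := by
      rw [Nat.cast_zero, zero_sub, neg_ne_zero]
      exact Nat.cast_ne_zero.2 (Nat.succ_ne_zero D)
    exact (W.smul_mem_iff h4).1 h3

variable {σ : Type}

/-- The Euler derivation centered at a point. -/
noncomputable def eulerAt (a : σ → ℂ) : Derivation ℂ (MvPolynomial σ ℂ) (MvPolynomial σ ℂ) :=
  MvPolynomial.mkDerivation ℂ fun k => MvPolynomial.X k - MvPolynomial.C (a k)

/-- The translation by a vector. -/
noncomputable def translate (a : σ → ℂ) : MvPolynomial σ ℂ →ₐ[ℂ] MvPolynomial σ ℂ :=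
  MvPolynomial.aeval fun k => MvPolynomial.X k - MvPolynomial.C (a k)

theorem eulerAt_X (a : σ → ℂ) (k : σ) :
    eulerAt a (MvPolynomial.X k) = MvPolynomial.X k - MvPolynomial.C (a k) :=
  MvPolynomial.mkDerivation_X ..

theorem eulerAt_translate (a : σ → ℂ) (p : MvPolynomial σ ℂ) :
    eulerAt a (translate a p) = translate a (eulerAt 0 p) := by
  induction p using MvPolynomial.induction_on with
  | C r =>
    rw [← MvPolynomial.algebraMap_eq, AlgHom.commutes, Derivation.map_algebraMap,
      Derivation.map_algebraMap, map_zero]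
  | add p q hp hq => rw [map_add, map_add, hp, hq, map_add, map_add]
  | mul_X p l hp =>
    have hX : translate a (MvPolynomial.X l) = MvPolynomial.X l - MvPolynomial.C (a l) :=
      MvPolynomial.aeval_X ..
    have h : eulerAt a (translate a (MvPolynomial.X l)) =
        translate a (eulerAt 0 (MvPolynomial.X l)) := by
      rw [hX, map_sub, eulerAt_X, ← MvPolynomial.algebraMap_eq, Derivation.map_algebraMap,
        eulerAt_X]
      simp [hX]
    rw [map_mul, Derivation.leibniz, Derivation.leibniz, hp, h]
    simp

theorem translate_neg (a : σ → ℂ) (p : MvPolynomial σ ℂ) :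
    translate a (translate (-a) p) = p := by
  have : (translate a).comp (translate (-a)) = AlgHom.id ℂ _ := by
    ext k
    simp [translate, MvPolynomial.algHom_C, sub_eq_add_neg]
  exact DFunLike.congr_fun this p

variable [Fintype σ]

theorem eulerAt_zero_of_isHomogeneous {p : MvPolynomial σ ℂ} {t : ℕ} (h : p.IsHomogeneous t) :
    eulerAt 0 p = (t : ℂ) • p := by
  classical
  have : (eulerAt (0 : σ → ℂ)) = ∑ k, (MvPolynomial.X k : MvPolynomial σ ℂ) • MvPolynomial.pderiv k := by
    refine MvPolynomial.derivation_ext fun k => ?_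
    rw [derivation_sum_apply, eulerAt_X]
    simp [MvPolynomial.pderiv_X, Pi.single_apply]
  rw [this, derivation_sum_apply, Nat.cast_smul_eq_nsmul, ← h.sum_X_mul_pderiv]
  rfl

/-- The homogeneous components of `p` around `a` are eigenvectors of the Euler field, with their
degrees as eigenvalues. So `I` contains the component of degree `0`, the constant `p(a)`. -/
theorem one_mem_of_eulerAt_stable {I : Ideal (MvPolynomial σ ℂ)} (a : σ → ℂ)
    (hI : ∀ p ∈ I, eulerAt a p ∈ I) {p : MvPolynomial σ ℂ} (hp : p ∈ I)
    (hpa : MvPolynomial.eval a p ≠ 0) : (1 : MvPolynomial σ ℂ) ∈ I := by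
  have hsum := MvPolynomial.sum_homogeneousComponent (translate (-a) p)
  have h0 := mem_of_sum_eigenvectors_mem (eulerAt a).toLinearMap (W := I.restrictScalars ℂ) hI
    (translate (-a) p).totalDegree
    (p := fun t => translate a (MvPolynomial.homogeneousComponent t (translate (-a) p)))
    (fun t => by
      change eulerAt a _ = _
      rw [eulerAt_translate, eulerAt_zero_of_isHomogeneous
        (MvPolynomial.homogeneousComponent_isHomogeneous t _), map_smul])
    (by rw [← map_sum, hsum, translate_neg]; exact hp)
  have hcoeff : MvPolynomial.coeff 0 (translate (-a) p) = MvPolynomial.eval a p := by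
    rw [← MvPolynomial.constantCoeff_eq]
    have : (MvPolynomial.constantCoeff : MvPolynomial σ ℂ →+* ℂ).comp
        (translate (-a) : MvPolynomial σ ℂ →+* MvPolynomial σ ℂ) = MvPolynomial.eval a := by
      ext k
      · simp [translate, MvPolynomial.algHom_C]
      · simp [translate]
    exact DFunLike.congr_fun this p
  simp only [MvPolynomial.homogeneousComponent_zero, hcoeff, MvPolynomial.algHom_C] at h0
  have h1 : MvPolynomial.C (MvPolynomial.eval a p)⁻¹ * MvPolynomial.C (MvPolynomial.eval a p) ∈ I :=
    I.mul_mem_left _ h0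
  rwa [← MvPolynomial.C_mul, inv_mul_cancel₀ hpa, MvPolynomial.C_1] at h1

/-- A local containment at the center of a quasi-homogeneous function is global. -/
theorem clearIdeal_eq_top_of_eulerAt {F : MvPolynomial σ ℂ} (hF : F ≠ 0) (a : σ → ℂ) {D : ℂ}
    (hD : eulerAt a F = D • F) {c : ℂ[X]} {p : MvPolynomial σ ℂ} (hp : p ∈ clearIdeal F c)
    (hpa : MvPolynomial.eval a p ≠ 0) : clearIdeal F c = ⊤ := by
  rw [Ideal.eq_top_iff_one]
  refine one_mem_of_eulerAt_stable a (fun q hq => ?_) hp hpa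
  have hF' : ratMap σ F ≠ 0 := by rwa [Ne, IsFractionRing.to_map_eq_zero_iff]
  obtain ⟨δ, hδ⟩ := exists_derivation_extend (K := MvRat σ) (eulerAt a)
  have hst := dMod_stable (polySub σ) (ratMap σ F)
  rw [mem_clearIdeal] at hq ⊢
  -- As `δ F / F` is the constant `D`, the action of `δ` sends `q c(s)` to `(eulerAt a q) c(s) + D s
  -- q c(s)`, and the last term is already in the module.
  have h1 := hst.nabla δ (by rintro _ ⟨x, rfl⟩; exact ⟨_, (hδ x).symm⟩) _ hq
  have h2 : δ (ratMap σ F) / ratMap σ F = algebraMap ℂ (MvRat σ) D := by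
    rw [div_eq_iff hF', hδ, hD, Algebra.smul_def, map_mul, ← IsScalarTower.algebraMap_apply]
  rw [nabla_C_mul, nabla, coeffDer_map, zero_add, h2, hδ] at h1
  have h3 := map_mul_mem_of_X_mul hst.X_mul (X * C D) hq
  rw [Polynomial.map_mul, map_X, map_C] at h3
  have h4 := sub_mem h1 h3
  rw [mul_left_comm, add_sub_cancel_right] at h4
  exact h4

end Euler


/-! ### Labellings of the index set and partitions. -/

section Combinatorics

variable {n : ℕ}

theorem exists_equiv_comp_eq {α β γ : Type*} [Fintype α] [Fintype β] [DecidableEq γ] (f : α → γ)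
    (g : β → γ) (h : ∀ c, (Finset.univ.filter fun a => f a = c).card =
      (Finset.univ.filter fun b => g b = c).card) : ∃ e : α ≃ β, ∀ a, g (e a) = f a := by
  have e : ∀ c, Nonempty ({a // f a = c} ≃ {b // g b = c}) := fun c => by
    rw [← Fintype.card_eq, Fintype.card_subtype, Fintype.card_subtype]
    exact h c
  exact ⟨Equiv.ofFiberEquiv fun c => (e c).some, fun a => Equiv.ofFiberEquiv_map _ a⟩

theorem card_index_eq (c : Composition n) (t : Fin c.length) :
    (Finset.univ.filter fun m => c.index m = t).card = c.blocksFun t := by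
  rw [← Finset.card_fin (c.blocksFun t), ← Finset.card_map (c.embedding t).toEmbedding]
  congr 1
  ext m
  simp only [Finset.mem_filter, Finset.mem_univ, true_and, Finset.mem_map]
  constructor
  · rintro rfl
    exact ⟨c.invEmbedding m, c.embedding_comp_inv m⟩
  · rintro ⟨k, rfl⟩
    exact c.index_embedding t k

theorem parts_eq_map_blocksFun (l : n.Partition) :
    Finset.univ.val.map (sortedParts l).blocksFun = l.parts := by
  have h : List.ofFn (sortedParts l).blocksFun = l.parts.sort (· ≥ ·) :=
    (sortedParts l).ofFn_blocksFun
  rw [Fin.univ_val_map, h, Multiset.sort_eq]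

theorem length_sortedParts (l : n.Partition) : (sortedParts l).length = l.parts.card := by
  rw [← parts_eq_map_blocksFun l]
  simp

/-- Every labelling of the index set is, up to a permutation, the block structure of a
partition. -/
theorem exists_partition_of_labelling {ι : Type*} [DecidableEq ι] (κ : Fin n → ι) :
    ∃ (l : n.Partition) (s : Equiv.Perm (Fin n)), ∀ m m',
      (sortedParts l).index m = (sortedParts l).index m' ↔ κ (s m) = κ (s m') := by
  let I := Finset.univ.image κ
  let κ' : Fin n → I := fun m => ⟨κ m, Finset.mem_image_of_mem κ (Finset.mem_univ m)⟩
  let c : I → ℕ := fun x => (Finset.univ.filter fun m => κ' m = x).card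
  let l : n.Partition :=
    { parts := Finset.univ.val.map c
      parts_pos := by
        intro i hi
        obtain ⟨⟨x, hx⟩, -, rfl⟩ := Multiset.mem_map.1 hi
        obtain ⟨m, -, rfl⟩ := Finset.mem_image.1 hx
        exact Finset.card_pos.2 ⟨m, by simp [κ']⟩
      parts_sum := by
        change ∑ x, c x = n
        rw [← Finset.card_eq_sum_card_fiberwise fun m _ => Finset.mem_univ _, Finset.card_fin] }
  -- `β` pairs blocks with labels of the same multiplicity; `s` then pairs the elements of each
  -- block with those carrying its label.
  obtain ⟨β, hβ⟩ := exists_equiv_comp_eq (sortedParts l).blocksFun c (fun k => by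
    have h := congrArg (Multiset.count k) (parts_eq_map_blocksFun l)
    change _ = Multiset.count k (Finset.univ.val.map c) at h
    rw [Multiset.count_map, Multiset.count_map] at h
    simpa only [Finset.card_def, Finset.filter_val, @eq_comm _ k] using h)
  obtain ⟨s, hs⟩ := exists_equiv_comp_eq (fun m => β ((sortedParts l).index m)) κ' (fun x => by
    have : ∀ m, β ((sortedParts l).index m) = x ↔ (sortedParts l).index m = β.symm x := fun m =>
      β.eq_symm_apply.symm
    simp only [this]
    rw [card_index_eq, ← hβ, β.apply_symm_apply])
  refine ⟨l, s, fun m m' => ?_⟩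
  rw [← β.injective.eq_iff, ← hs, ← hs, Subtype.mk.injEq]

theorem index_eq_of_indiscrete (m m' : Fin n) :
    (sortedParts (Nat.Partition.indiscrete n)).index m =
      (sortedParts (Nat.Partition.indiscrete n)).index m' := by
  have hn : n ≠ 0 := by
    rintro rfl
    exact m.elim0
  have h : (sortedParts (Nat.Partition.indiscrete n)).length = 1 := by
    rw [length_sortedParts, Nat.Partition.indiscrete_parts hn, Multiset.card_singleton]
  exact Fin.ext (by omega)

theorem exists_index_ne {l : n.Partition} (hl : l ≠ Nat.Partition.indiscrete n) :
    ∃ i j, (sortedParts l).index i ≠ (sortedParts l).index j := by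
  by_contra! h
  apply hl
  have hlen : (sortedParts l).length ≤ 1 := by
    by_contra! h1
    let t (k : ℕ) (hk : k < 2) : Fin (sortedParts l).length := ⟨k, by omega⟩
    have h2 := h ((sortedParts l).embedding (t 0 (by omega)) ⟨0, (sortedParts l).blocks_pos'  _ _⟩)
      ((sortedParts l).embedding (t 1 (by omega)) ⟨0, (sortedParts l).blocks_pos' _ _⟩)
    rw [Composition.index_embedding, Composition.index_embedding] at h2
    simp [t] at h2
  rw [length_sortedParts, Nat.le_one_iff_eq_zero_or_eq_one, Multiset.card_eq_zero,
    Multiset.card_eq_one] at hlen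
  have hsum := l.parts_sum
  rcases hlen with h0 | ⟨x, hx⟩
  · rw [h0, Multiset.sum_zero] at hsum
    subst hsum
    exact Subsingleton.elim _ _
  · rw [hx, Multiset.sum_singleton] at hsum
    subst hsum
    have hx0 : x ≠ 0 := (l.parts_pos (i := x) (by simp [hx])).ne'
    exact Nat.Partition.ext (by rw [hx, Nat.Partition.indiscrete_parts hx0])

end Combinatorics

/-! ### Products of differences within blocks. -/

section BlockProducts

variable {n : ℕ}

/-- The pairs `i < j`. -/
def ltPairs (n : ℕ) : Finset (Fin n × Fin n) :=
  (Finset.univ ×ˢ Finset.univ).filter fun q => q.1 < q.2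

theorem mem_ltPairs {q : Fin n × Fin n} : q ∈ ltPairs n ↔ q.1 < q.2 := by
  simp [ltPairs]

/-- The product of the differences of functions with equal labels. -/
noncomputable def blockProd {ι : Type*} [DecidableEq ι] (κ : Fin n → ι) (v : Fin n → CoordRing n) :
    CoordRing n := ∏ q ∈ (ltPairs n).filter fun q => κ q.1 = κ q.2, (v q.1 - v q.2)

theorem xi_eq_prod : xi n = ∏ q ∈ ltPairs n, (MvPolynomial.X q.1 - MvPolynomial.X q.2) := rfl

theorem card_ltPairs (n : ℕ) : (ltPairs n).card = n.choose 2 := by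
  have h : ∀ j : Fin n, ((ltPairs n).filter fun q => q.2 = j).card = j := by
    intro j
    rw [← Fin.card_Iio j]
    refine Finset.card_nbij' Prod.fst (fun i => (i, j)) ?_ ?_ ?_ ?_
    · rintro ⟨a, b⟩ hq
      simp only [Finset.coe_filter, Set.mem_ofPred_eq, mem_ltPairs] at hq
      simpa using hq.2 ▸ hq.1
    · intro a ha
      simp_all [ltPairs]
    · rintro ⟨a, b⟩ hq
      simp_all
    · exact fun a _ => rfl
  rw [Finset.card_eq_sum_card_fiberwise (f := Prod.snd) (t := Finset.univ)
    fun q _ => Finset.mem_univ _]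
  simp only [h]
  rw [Fin.sum_univ_eq_sum_range fun i => i, Finset.sum_range_id, Nat.choose_two_right]

theorem xiPartition_eq_blockProd (l : n.Partition) :
    xiPartition l = blockProd (sortedParts l).index MvPolynomial.X := by
  rw [blockProd, ← Finset.prod_fiberwise _ fun q => (sortedParts l).index q.1]
  refine Finset.prod_congr rfl fun t _ => Finset.prod_congr ?_ fun _ _ => rfl
  ext q
  simp only [ltPairs, Finset.mem_filter, Finset.mem_product, Finset.mem_univ, true_and]
  constructor
  · rintro ⟨⟨h1, h2⟩, h3⟩
    exact ⟨⟨h3, h1.trans h2.symm⟩, h1⟩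
  · rintro ⟨⟨h3, h2⟩, h1⟩
    exact ⟨⟨h1, h2 ▸ h1⟩, h3⟩

/-- A permutation moves the increasing pairs to pairs that may have to be swapped, at the price of a
sign; `F s` below applies `s` and sorts. -/
theorem blockProd_comp_perm_associated {ι : Type*} [DecidableEq ι] (κ : Fin n → ι)
    (v : Fin n → CoordRing n) (s : Equiv.Perm (Fin n)) :
    Associated (blockProd (κ ∘ s) (v ∘ s)) (blockProd κ v) := by
  let F : Equiv.Perm (Fin n) → Fin n × Fin n → Fin n × Fin n := fun s q =>
    if s q.1 < s q.2 then (s q.1, s q.2) else (s q.2, s q.1)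
  have hF : ∀ s q, q ∈ ltPairs n → F s q ∈ ltPairs n := by
    intro s q hq
    simp only [F, mem_ltPairs] at *
    split_ifs with h
    · exact h
    · exact lt_of_le_of_ne (not_lt.1 h) fun h' => hq.ne' (s.injective h')
  have hFF : ∀ s q, q ∈ ltPairs n → F s.symm (F s q) = q := by
    intro s q hq
    simp only [F, mem_ltPairs] at *
    split_ifs with h h' h' <;> simp_all [hq.not_gt]
  have hass : Associated (blockProd (κ ∘ s) (v ∘ s))
      (∏ q ∈ (ltPairs n).filter (fun q => κ (s q.1) = κ (s q.2)),
        (v (F s q).1 - v (F s q).2)) := by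
    refine Associated.prod _ _ _ fun q _ => ?_
    simp only [F]
    split_ifs
    · exact Associated.refl _
    · rw [← neg_sub]
      exact Associated.neg_left (Associated.refl _)
  refine hass.trans (Associated.of_eq ?_)
  refine Finset.prod_nbij' (F s) (F s.symm) ?_ ?_ ?_ ?_ ?_
  · intro q hq
    rw [Finset.mem_filter] at hq ⊢
    refine ⟨hF s q hq.1, ?_⟩
    simp only [F]
    split_ifs
    exacts [hq.2, hq.2.symm]
  · intro q hq
    rw [Finset.mem_filter] at hq ⊢
    refine ⟨hF _ q hq.1, ?_⟩
    simp only [F]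
    split_ifs
    · simpa using hq.2
    · simpa using hq.2.symm
  · exact fun q hq => hFF s q (Finset.mem_filter.1 hq).1
  · exact fun q hq => hFF s.symm q (Finset.mem_filter.1 hq).1
  · exact fun _ _ => rfl

end BlockProducts


/-! ### The pulled-back Vandermonde determinant on a chart and its local models. -/

section Chart

variable {n : ℕ} (i j : Fin n)

/-- The pullbacks of the functions `(x_k - x_j) / (x_i - x_j)` to the affine chart of the blow-up
where `x_i - x_j` generates the exceptional divisor. The coordinates of the chart are `X j = x_j`,
`X i = x_i - x_j`, and `X k = (x_k - x_j) / (x_i - x_j)` for the other indices `k`. -/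
noncomputable def chartV (k : Fin n) : CoordRing n :=
  if k = i then 1 else if k = j then 0 else MvPolynomial.X k

/-- The pullback of the Vandermonde determinant to a chart of the blow-up. -/
noncomputable def chartFun : CoordRing n :=
  MvPolynomial.X i ^ n.choose 2 * ∏ q ∈ ltPairs n, (chartV i j q.1 - chartV i j q.2)

theorem chartV_left : chartV i j i = 1 := if_pos rfl

variable {i j}

theorem chartV_right (hij : i ≠ j) : chartV i j j = 0 := by
  rw [chartV, if_neg hij.symm, if_pos rfl]

theorem chartV_of_ne {k : Fin n} (hi : k ≠ i) (hj : k ≠ j) : chartV i j k = MvPolynomial.X k := by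
  rw [chartV, if_neg hi, if_neg hj]

theorem chartV_injective (hij : i ≠ j) : Function.Injective (chartV i j) := by
  have hX : ∀ k : Fin n, (MvPolynomial.X k : CoordRing n) ≠ 0 := fun k => MvPolynomial.X_ne_zero k
  have hX1 : ∀ k : Fin n, (MvPolynomial.X k : CoordRing n) ≠ 1 := fun k h => by
    have := congrArg (MvPolynomial.eval 0) h
    simp at this
  intro k l h
  unfold chartV at h
  split_ifs at h with h1 h2 h3 h4 h5 h6 h7 h8
  all_goals first
    | (subst_vars; rfl)
    | exact absurd h one_ne_zero
    | exact absurd h.symm one_ne_zero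
    | exact absurd h (hX _)
    | exact absurd h.symm (hX _)
    | exact absurd h (hX1 _)
    | exact absurd h.symm (hX1 _)
    | exact MvPolynomial.X_injective h

theorem prod_chartV_ne_zero (hij : i ≠ j) {s : Finset (Fin n × Fin n)} (hs : s ⊆ ltPairs n) :
    ∏ q ∈ s, (chartV i j q.1 - chartV i j q.2) ≠ 0 :=
  Finset.prod_ne_zero_iff.2 fun _ hq h =>
    (mem_ltPairs.1 (hs hq)).ne (chartV_injective hij (sub_eq_zero.1 h))

theorem chartFun_ne_zero (hij : i ≠ j) : chartFun i j ≠ 0 :=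
  mul_ne_zero (pow_ne_zero _ (MvPolynomial.X_ne_zero i)) (prod_chartV_ne_zero hij subset_rfl)

theorem pderiv_chartV (k : Fin n) : MvPolynomial.pderiv i (chartV i j k) = 0 := by
  unfold chartV
  split_ifs with h1
  · exact MvPolynomial.pderiv_one
  · exact map_zero _
  · exact MvPolynomial.pderiv_X_of_ne h1

theorem derivation_prod_eq {ι A : Type*} [CommRing A] [Algebra ℂ A] (D : Derivation ℂ A A)
    (s : Finset ι) (f : ι → A) (r : ℂ) (h : ∀ q ∈ s, D (f q) = r • f q) :
    D (∏ q ∈ s, f q) = (s.card * r : ℂ) • ∏ q ∈ s, f q := by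
  classical
  induction s using Finset.induction_on with
  | empty => simp
  | insert a s ha ih =>
    rw [Finset.prod_insert ha, Derivation.leibniz, ih fun q hq => h q (Finset.mem_insert_of_mem hq),
      h a (Finset.mem_insert_self a s), Finset.card_insert_of_notMem ha]
    simp only [smul_eq_mul, mul_smul_comm]
    rw [mul_comm (∏ q ∈ s, f q), ← add_smul]
    congr 1
    push_cast
    ring

theorem eulerAt_chartV (a : Fin n → ℂ) (k : Fin n) :
    eulerAt a (chartV i j k) = chartV i j k - MvPolynomial.C (MvPolynomial.eval a (chartV i j k)) := by
  unfold chartV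
  split_ifs
  · simp
  · simp
  · rw [eulerAt_X, MvPolynomial.eval_X]

section Point

variable (i j) (a : Fin n → ℂ)

/-- The values of the functions `(x_k - x_j) / (x_i - x_j)` at a point of the chart. -/
noncomputable def chartVal (k : Fin n) : ℂ := MvPolynomial.eval a (chartV i j k)

/-- The product of the factors that do not vanish at a point of the chart. -/
noncomputable def crossProd : CoordRing n :=
  ∏ q ∈ (ltPairs n).filter fun q => ¬ chartVal i j a q.1 = chartVal i j a q.2,
    (chartV i j q.1 - chartV i j q.2)

theorem chartFun_eq : chartFun i j = crossProd i j a *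
    (MvPolynomial.X i ^ n.choose 2 * blockProd (chartVal i j a) (chartV i j)) := by
  rw [chartFun, crossProd, blockProd, ← Finset.prod_filter_mul_prod_filter_not (ltPairs n)
    fun q => chartVal i j a q.1 = chartVal i j a q.2]
  ring

theorem eval_crossProd_ne_zero : MvPolynomial.eval a (crossProd i j a) ≠ 0 := by
  rw [crossProd, map_prod]
  refine Finset.prod_ne_zero_iff.2 fun q hq => ?_
  rw [map_sub, sub_ne_zero]
  exact (Finset.mem_filter.1 hq).2

theorem crossProd_ne_zero : crossProd i j a ≠ 0 := fun h =>
  eval_crossProd_ne_zero i j a (by rw [h, map_zero])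

variable {i j}

theorem blockProd_chartV_ne_zero (hij : i ≠ j) : blockProd (chartVal i j a) (chartV i j) ≠ 0 :=
  prod_chartV_ne_zero hij (Finset.filter_subset _ _)

theorem pderiv_blockProd_chartV :
    MvPolynomial.pderiv i (blockProd (chartVal i j a) (chartV i j)) = 0 := by
  rw [blockProd, derivation_prod_eq _ _ _ 0, mul_zero, zero_smul]
  intro q _
  rw [map_sub, pderiv_chartV, pderiv_chartV, sub_self, zero_smul]

/-- The remaining factors are of degree at most one and vanish at `a`, hence are eigenvectors with
eigenvalue `1`. For `X i` this requires `a` to lie on the exceptional divisor. -/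
theorem eulerAt_blockProd_chartV (ha : a i = 0) : ∃ D : ℂ,
    eulerAt a (MvPolynomial.X i ^ n.choose 2 * blockProd (chartVal i j a) (chartV i j)) =
      D • (MvPolynomial.X i ^ n.choose 2 * blockProd (chartVal i j a) (chartV i j)) := by
  have h1 := derivation_prod_eq (eulerAt a) ((ltPairs n).filter fun q =>
    chartVal i j a q.1 = chartVal i j a q.2) (fun q => chartV i j q.1 - chartV i j q.2) 1 (by
      intro q hq
      have hq' : MvPolynomial.eval a (chartV i j q.1) = MvPolynomial.eval a (chartV i j q.2) :=
        (Finset.mem_filter.1 hq).2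
      rw [map_sub, eulerAt_chartV, eulerAt_chartV, hq', one_smul]
      ring)
  have h2 := derivation_prod_eq (eulerAt a) (Finset.range (n.choose 2))
    (fun _ => (MvPolynomial.X i : CoordRing n)) 1 (by
      intro q _
      rw [eulerAt_X, ha, one_smul, map_zero, sub_zero])
  rw [Finset.prod_const, Finset.card_range] at h2
  change eulerAt a (blockProd _ _) = _ • blockProd (chartVal i j a) (chartV i j) at h1
  exact ⟨_, by
    rw [Derivation.leibniz, h1, h2, smul_eq_mul, smul_eq_mul, mul_smul_comm, mul_smul_comm,
      mul_comm (blockProd _ _), ← add_smul]⟩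

end Point

section Straighten

variable (i j) (a : Fin n → ℂ)

/-- The linear change of coordinates that takes differences of coordinates with equal labels to
differences of the functions `(x_k - x_j) / (x_i - x_j)`. -/
noncomputable def straightenHom : CoordRing n →ₐ[ℂ] CoordRing n :=
  MvPolynomial.aeval fun k => chartV i j k + if chartVal i j a k = 1 then MvPolynomial.X i else
    if chartVal i j a k = 0 then MvPolynomial.X j else 0

/-- The inverse of `straightenHom`. -/
noncomputable def straightenInv : CoordRing n →ₐ[ℂ] CoordRing n :=
  MvPolynomial.aeval fun k => if k = i then MvPolynomial.X i - 1 else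
    if k = j then MvPolynomial.X j else MvPolynomial.X k - if a k = 1 then MvPolynomial.X i - 1 else
      if a k = 0 then MvPolynomial.X j else 0

variable {i j}

theorem chartVal_left : chartVal i j a i = 1 := by rw [chartVal, chartV_left, map_one]

theorem chartVal_right (hij : i ≠ j) : chartVal i j a j = 0 := by
  rw [chartVal, chartV_right hij, map_zero]

theorem chartVal_of_ne {k : Fin n} (hi : k ≠ i) (hj : k ≠ j) : chartVal i j a k = a k := by
  rw [chartVal, chartV_of_ne hi hj, MvPolynomial.eval_X]

theorem straightenHom_left : straightenHom i j a (MvPolynomial.X i) = 1 + MvPolynomial.X i := by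
  rw [straightenHom, MvPolynomial.aeval_X, chartVal_left, if_pos rfl, chartV_left]

theorem straightenHom_right (hij : i ≠ j) :
    straightenHom i j a (MvPolynomial.X j) = MvPolynomial.X j := by
  rw [straightenHom, MvPolynomial.aeval_X, chartVal_right a hij, if_neg zero_ne_one, if_pos rfl,
    chartV_right hij, zero_add]

theorem straightenHom_of_ne {k : Fin n} (hi : k ≠ i) (hj : k ≠ j) :
    straightenHom i j a (MvPolynomial.X k) = MvPolynomial.X k + if a k = 1 then MvPolynomial.X i else
      if a k = 0 then MvPolynomial.X j else 0 := by
  rw [straightenHom, MvPolynomial.aeval_X, chartVal_of_ne a hi hj, chartV_of_ne hi hj]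

theorem straightenInv_left : straightenInv i j a (MvPolynomial.X i) = MvPolynomial.X i - 1 := by
  rw [straightenInv, MvPolynomial.aeval_X, if_pos rfl]

theorem straightenInv_right (hij : i ≠ j) :
    straightenInv i j a (MvPolynomial.X j) = MvPolynomial.X j := by
  rw [straightenInv, MvPolynomial.aeval_X, if_neg hij.symm, if_pos rfl]

theorem straightenInv_of_ne {k : Fin n} (hi : k ≠ i) (hj : k ≠ j) :
    straightenInv i j a (MvPolynomial.X k) = MvPolynomial.X k - if a k = 1 then MvPolynomial.X i - 1
      else if a k = 0 then MvPolynomial.X j else 0 := by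
  rw [straightenInv, MvPolynomial.aeval_X, if_neg hi, if_neg hj]

/-- `straightenHom` as an automorphism. -/
noncomputable def straighten (hij : i ≠ j) : CoordRing n ≃ₐ[ℂ] CoordRing n :=
  AlgEquiv.ofAlgHom (straightenHom i j a) (straightenInv i j a)
    (by
      refine MvPolynomial.algHom_ext fun k => ?_
      rw [AlgHom.comp_apply, AlgHom.id_apply]
      by_cases hi : k = i
      · rw [hi, straightenInv_left, map_sub, map_one, straightenHom_left]
        ring
      by_cases hj : k = j
      · rw [hj, straightenInv_right a hij, straightenHom_right a hij]
      rw [straightenInv_of_ne a hi hj, map_sub, straightenHom_of_ne a hi hj]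
      split_ifs
      · rw [map_sub, map_one, straightenHom_left]
        ring
      · rw [straightenHom_right a hij]
        ring
      · rw [map_zero]
        ring)
    (by
      refine MvPolynomial.algHom_ext fun k => ?_
      rw [AlgHom.comp_apply, AlgHom.id_apply]
      by_cases hi : k = i
      · rw [hi, straightenHom_left, map_add, map_one, straightenInv_left]
        ring
      by_cases hj : k = j
      · rw [hj, straightenHom_right a hij, straightenInv_right a hij]
      rw [straightenHom_of_ne a hi hj, map_add, straightenInv_of_ne a hi hj]
      split_ifs
      · rw [straightenInv_left]
        ring
      · rw [straightenInv_right a hij]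
        ring
      · rw [map_zero]
        ring)

/-- The term added to `chartV i j k` depends only on the label of `k`, so it cancels within a block.
Since `v_i` and `v_j` are constants, the blocks of `i` and `j` are shifted by the otherwise absent
variables `X i` and `X j`, which makes the map invertible. -/
theorem straighten_sub (hij : i ≠ j) {k l : Fin n} (h : chartVal i j a k = chartVal i j a l) :
    straighten a hij (MvPolynomial.X k - MvPolynomial.X l) = chartV i j k - chartV i j l := by
  change straightenHom i j a _ = _
  rw [straightenHom, map_sub, MvPolynomial.aeval_X, MvPolynomial.aeval_X, h]
  ring

theorem X_prod_ne_zero {ι : Type*} [DecidableEq ι] (κ : Fin n → ι) :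
    blockProd κ MvPolynomial.X ≠ 0 :=
  Finset.prod_ne_zero_iff.2 fun _ hq h =>
    (mem_ltPairs.1 (Finset.mem_filter.1 hq).1).ne (MvPolynomial.X_injective (sub_eq_zero.1 h))

/-- The b-function of a block product only depends on the block structure. -/
theorem bFunction_blockProd_chartV_dvd_iff (hij : i ≠ j) {ι : Type*} [DecidableEq ι]
    {κ : Fin n → ι} (s : Equiv.Perm (Fin n))
    (hκ : ∀ m m', κ m = κ m' ↔ chartVal i j a (s m) = chartVal i j a (s m')) (c : ℂ[X]) :
    bFunction (blockProd (chartVal i j a) (chartV i j)) ∣ c ↔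
      bFunction (blockProd κ MvPolynomial.X) ∣ c := by
  let e := (MvPolynomial.renameEquiv ℂ s).trans (straighten a hij)
  have h : e (blockProd κ MvPolynomial.X) = blockProd (chartVal i j a ∘ s) (chartV i j ∘ s) := by
    rw [blockProd, blockProd, map_prod]
    have hf : (ltPairs n).filter (fun q => κ q.1 = κ q.2) =
        (ltPairs n).filter fun q => (chartVal i j a ∘ s) q.1 = (chartVal i j a ∘ s) q.2 :=
      Finset.filter_congr fun q _ => hκ _ _
    rw [hf]
    refine Finset.prod_congr rfl fun q hq => ?_
    rw [AlgEquiv.trans_apply, map_sub, MvPolynomial.renameEquiv_apply, MvPolynomial.renameEquiv_apply,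
      MvPolynomial.rename_X, MvPolynomial.rename_X,
      straighten_sub a hij (Finset.mem_filter.1 hq).2]
    rfl
  have hass := blockProd_comp_perm_associated (chartVal i j a) (chartV i j) s
  rw [← bFunction_dvd_of_algEquiv e (X_prod_ne_zero κ), h]
  exact ⟨bFunction_dvd_of_associated hass.symm (blockProd_chartV_ne_zero a hij),
    bFunction_dvd_of_associated hass (hass.ne_zero_iff.2 (blockProd_chartV_ne_zero a hij))⟩

end Straighten

section Local

theorem bFunction_away_crossProd_dvd_iff (hij : i ≠ j) (a : Fin n → ℂ) (c : ℂ[X]) :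
    bFunction (algebraMap _ (Localization.Away (crossProd i j a)) (chartFun i j)) ∣ c ↔
      bFunction (algebraMap _ (Localization.Away (crossProd i j a))
        (MvPolynomial.X i ^ n.choose 2 * blockProd (chartVal i j a) (chartV i j))) ∣ c := by
  have hdom : IsDomain (Localization.Away (crossProd i j a)) :=
    IsLocalization.isDomain_localization
      (powers_le_nonZeroDivisors_of_noZeroDivisors (crossProd_ne_zero i j a))
  have hinj : Function.Injective
      (algebraMap (CoordRing n) (Localization.Away (crossProd i j a))) :=
    IsLocalization.injective _
      (powers_le_nonZeroDivisors_of_noZeroDivisors (crossProd_ne_zero i j a))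
  have hu := IsLocalization.Away.algebraMap_isUnit (S := Localization.Away (crossProd i j a))
    (crossProd i j a)
  have hass : Associated (algebraMap _ (Localization.Away (crossProd i j a)) (chartFun i j))
      (algebraMap _ (Localization.Away (crossProd i j a))
        (MvPolynomial.X i ^ n.choose 2 * blockProd (chartVal i j a) (chartV i j))) := by
    rw [chartFun_eq i j a, map_mul]
    exact associated_unit_mul_left _ _ hu
  have h0 : algebraMap _ (Localization.Away (crossProd i j a)) (chartFun i j) ≠ 0 := by
    rw [Ne, map_eq_zero_iff _ hinj]
    exact chartFun_ne_zero hij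
  exact ⟨bFunction_dvd_of_associated hass h0,
    bFunction_dvd_of_associated hass.symm (hass.ne_zero_iff.1 h0)⟩

/-- By the Nullstellensatz, a proper `clearIdeal` would vanish at some point `a`; the local model at
`a` puts a power of `crossProd i j a`, nonzero at `a`, in it. -/
theorem bFunction_chartFun_dvd (hij : i ≠ j) {c : ℂ[X]}
    (hc : ∀ l : n.Partition, l ≠ Nat.Partition.indiscrete n → bFunction (xiPartition l) ∣ c) :
    bFunction (chartFun i j) ∣ powPoly (n.choose 2) * c := by
  rw [← clearIdeal_eq_top_iff (chartFun_ne_zero hij)]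
  by_contra htop
  obtain ⟨M, hM, hle⟩ := Ideal.exists_le_maximal _ htop
  obtain ⟨a, rfl⟩ := MvPolynomial.isMaximal_iff_eq_vanishingIdeal_singleton.1 hM
  obtain ⟨l, s, hs⟩ := exists_partition_of_labelling (chartVal i j a)
  -- The labels of `i` and `j` are `1` and `0`, so there are at least two blocks.
  have hl : l ≠ Nat.Partition.indiscrete n := by
    rintro rfl
    have h := (hs (s.symm i) (s.symm j)).1 (index_eq_of_indiscrete _ _)
    rw [s.apply_symm_apply, s.apply_symm_apply, chartVal_left, chartVal_right a hij] at h
    exact one_ne_zero h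
  have h1 := hc l hl
  rw [xiPartition_eq_blockProd, ← bFunction_blockProd_chartV_dvd_iff a hij s hs] at h1
  have h2 := bFunction_pow_mul_dvd (d := n.choose 2) (blockProd_chartV_ne_zero a hij)
    (pderiv_blockProd_chartV a) h1
  have h3 := bFunction_away_dvd (Localization.Away (crossProd i j a)) (crossProd_ne_zero i j a)
    (mul_ne_zero (pow_ne_zero _ (MvPolynomial.X_ne_zero i)) (blockProd_chartV_ne_zero a hij)) h2
  rw [← bFunction_away_crossProd_dvd_iff hij] at h3
  obtain ⟨N, hN⟩ := exists_pow_mem_clearIdeal (Localization.Away (crossProd i j a))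
    (crossProd_ne_zero i j a) (chartFun_ne_zero hij) h3
  have h4 := hle hN
  rw [MvPolynomial.mem_vanishingIdeal_singleton_iff, map_pow] at h4
  exact pow_ne_zero N (eval_crossProd_ne_zero i j a) h4

/-- On the exceptional divisor the local model is quasi-homogeneous, so inverting `crossProd i j a`
loses nothing about its b-function, and the power of `X i` splits off. -/
theorem exists_of_bFunction_chartFun_dvd (hij : i ≠ j) {c : ℂ[X]} (hc : bFunction (chartFun i j) ∣ c)
    (a : Fin n → ℂ) (ha : a i = 0) : ∃ c', c = powPoly (n.choose 2) * c' ∧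
      bFunction (blockProd (chartVal i j a) (chartV i j)) ∣ c' := by
  have hF : MvPolynomial.X i ^ n.choose 2 * blockProd (chartVal i j a) (chartV i j) ≠ 0 :=
    mul_ne_zero (pow_ne_zero _ (MvPolynomial.X_ne_zero i)) (blockProd_chartV_ne_zero a hij)
  have h1 := bFunction_away_dvd (Localization.Away (crossProd i j a)) (crossProd_ne_zero i j a)
    (chartFun_ne_zero hij) hc
  rw [bFunction_away_crossProd_dvd_iff hij] at h1
  obtain ⟨N, hN⟩ := exists_pow_mem_clearIdeal (Localization.Away (crossProd i j a))
    (crossProd_ne_zero i j a) hF h1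
  obtain ⟨D, hD⟩ := eulerAt_blockProd_chartV (j := j) a ha
  have h2 := clearIdeal_eq_top_of_eulerAt hF a hD hN (by
    rw [map_pow]
    exact pow_ne_zero _ (eval_crossProd_ne_zero i j a))
  rw [clearIdeal_eq_top_iff hF] at h2
  exact exists_of_bFunction_pow_mul_dvd (blockProd_chartV_ne_zero a hij)
    (pderiv_blockProd_chartV a) h2

end Local

end Chart

/-- The common multiples of the b-functions of the charts of the blow-up. -/
theorem forall_bFunction_chartFun_dvd_iff (n : ℕ) (c : ℂ[X]) :
    (∀ i j : Fin n, i ≠ j → bFunction (chartFun i j) ∣ c) ↔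
      ∃ c', c = powPoly (n.choose 2) * c' ∧
        ∀ l : n.Partition, l ≠ Nat.Partition.indiscrete n → bFunction (xiPartition l) ∣ c' := by
  constructor
  · intro h
    have hex : ∃ c', c = powPoly (n.choose 2) * c' := by
      by_cases hn : ∃ i j : Fin n, i ≠ j
      · obtain ⟨i, j, hij⟩ := hn
        -- Any point with `a i = 0` yields the factor; the origin will do.
        obtain ⟨c', hc', -⟩ := exists_of_bFunction_chartFun_dvd hij (h i j hij) 0 rfl
        exact ⟨c', hc'⟩
      -- With fewer than two coordinates there are no charts, and the factor is `1`.
      · have : n.choose 2 = 0 := by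
          refine Nat.choose_eq_zero_of_lt ?_
          by_contra! h2
          exact hn ⟨⟨0, by omega⟩, ⟨1, by omega⟩, by simp⟩
        exact ⟨c, by simp [this, powPoly]⟩
    obtain ⟨c', rfl⟩ := hex
    refine ⟨c', rfl, fun l hl => ?_⟩
    obtain ⟨i, j, hij⟩ := exists_index_ne hl
    have hne : i ≠ j := fun h => hij (by rw [h])
    have hd : (((sortedParts l).index i : ℕ) : ℂ) - (((sortedParts l).index j : ℕ) : ℂ) ≠ 0 := by
      rw [sub_ne_zero, Ne, Nat.cast_inj, Fin.val_inj]
      exact hij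
    -- The block numbers, normalized affinely to give `i` and `j` the labels `1` and `0` that the
    -- chart imposes. Setting `a i = 0` puts the point on the exceptional divisor and leaves the
    -- label of `i` unchanged.
    let a : Fin n → ℂ := fun k => if k = i then 0 else
      ((((sortedParts l).index k : ℕ) : ℂ) - (((sortedParts l).index j : ℕ) : ℂ)) /
        ((((sortedParts l).index i : ℕ) : ℂ) - (((sortedParts l).index j : ℕ) : ℂ))
    have hval : ∀ k, chartVal i j a k =
        ((((sortedParts l).index k : ℕ) : ℂ) - (((sortedParts l).index j : ℕ) : ℂ)) /
        ((((sortedParts l).index i : ℕ) : ℂ) - (((sortedParts l).index j : ℕ) : ℂ)) := by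
      intro k
      by_cases hi : k = i
      · rw [hi, chartVal_left, div_self hd]
      by_cases hj : k = j
      · rw [hj, chartVal_right a hne, sub_self, zero_div]
      rw [chartVal_of_ne a hi hj]
      exact if_neg hi
    obtain ⟨c'', hc'', hdvd⟩ := exists_of_bFunction_chartFun_dvd hne (h i j hne) a (if_pos rfl)
    rw [mul_left_cancel₀ (powPoly_ne_zero _) hc'', xiPartition_eq_blockProd,
      ← bFunction_blockProd_chartV_dvd_iff a hne (Equiv.refl _)]
    · exact hdvd
    · intro m m'
      rw [Equiv.refl_apply, Equiv.refl_apply, hval, hval, div_left_inj' hd, sub_left_inj,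
        Nat.cast_inj, Fin.val_inj]
  · rintro ⟨c', rfl, h⟩ i j hij
    exact bFunction_chartFun_dvd hij h


/-! ### From a cover by good open sets to all affine open sets. -/

section Gluing

theorem bFunction_dvd_of_subsingleton {A : Type*} [CommRing A] [Algebra ℂ A] [Subsingleton A]
    (f : A) (c : ℂ[X]) : bFunction f ∣ c := by
  have : Subsingleton (Localization.Away f) := IsLocalization.subsingleton
    (M := Submonoid.powers f) (R := A) ⟨1, by rw [Subsingleton.elim f 0]; exact Subsingleton.elim _ _⟩
  rw [bFunction, minpoly_sQuot_dvd_iff, Subsingleton.elim (c.map _) 0]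
  exact zero_mem _

/-- Powers of the elements of `s` lie in `clearIdeal f c`, so its radical is the whole ring. Finite
type, needed to clear denominators, is itself deduced from the localizations. -/
theorem bFunction_dvd_of_span_eq_top {A : Type} [CommRing A] [IsDomain A] [Algebra ℂ A] {f : A}
    (hf : f ≠ 0) {c : ℂ[X]} {s : Set A} (hs : Ideal.span s = ⊤)
    (H : ∀ h ∈ s, h ≠ 0 ∧ ∃ (A' : Type) (_ : CommRing A') (_ : Algebra ℂ A') (_ : Algebra A A')
      (_ : IsScalarTower ℂ A A') (_ : IsLocalization.Away h A'),
      (algebraMap ℂ A').FiniteType ∧ bFunction (algebraMap A A' f) ∣ c) : bFunction f ∣ c := by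
  have hft : (algebraMap ℂ A).FiniteType := by
    refine RingHom.finiteType_ofLocalizationSpanTarget.ofIsLocalization
      RingHom.finiteType_respectsIso _ s hs fun ⟨h, hh⟩ => ?_
    obtain ⟨-, A', _, _, _, _, hloc, hfin, -⟩ := H h hh
    refine ⟨A', _, _, hloc, ?_⟩
    rwa [← IsScalarTower.algebraMap_eq]
  have : Algebra.FiniteType ℂ A := (RingHom.finiteType_algebraMap).1 hft
  rw [← clearIdeal_eq_top_iff hf, ← Ideal.radical_eq_top, ← top_le_iff, ← hs, Ideal.span_le]
  intro h hh
  obtain ⟨h0, A', _, _, _, _, _, -, hdvd⟩ := H h hh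
  exact exists_pow_mem_clearIdeal A' h0 hf hdvd

variable {R : Type} [CommRing R] {Y : Scheme.{0}} (p : Y ⟶ Spec (CommRingCat.of R))

theorem pullbackHom_restrict {U V : Y.Opens} (i : V ≤ U) (r : R) :
    (Y.presheaf.map (homOfLE i).op).hom (pullbackHom p U r) = pullbackHom p V r := by
  have := Scheme.Hom.appLE_map (f := p) (U := ⊤) (V := U) (V' := V) le_top (homOfLE i).op
  rw [pullbackHom, pullbackHom, ← this]
  rfl

/-- The sections of an affine chart, together with the pullback of functions. -/
theorem exists_ringEquiv_opensRange {S : Type} [CommRing S]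
    (ι : Spec (CommRingCat.of S) ⟶ Y) [IsOpenImmersion ι] (φ : R →+* S)
    (hφ : ι ≫ p = Spec.map (CommRingCat.ofHom φ)) {U : Y.Opens} (hU : U = ι.opensRange) :
    ∃ e : Γ(Y, U) ≃+* S, ∀ r, e (pullbackHom p U r) = φ r := by
  have hle : ⊤ ≤ ι ⁻¹ᵁ U := by
    rw [hU, Scheme.Hom.preimage_opensRange]
  have h1 : IsIso (ι.app U) := Scheme.Hom.isIso_app ι U hU.le
  have h2 : IsIso (ι.appLE U ⊤ hle) := by
    have : ι ⁻¹ᵁ U = ⊤ := top_le_iff.1 hle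
    rw [Scheme.Hom.appLE]
    have : IsIso ((Spec (CommRingCat.of S)).presheaf.map (homOfLE hle).op) := by
      have : (homOfLE hle) = eqToHom this.symm := rfl
      rw [this]
      infer_instance
    infer_instance
  let E := asIso (ι.appLE U ⊤ hle) ≪≫ Scheme.ΓSpecIso (CommRingCat.of S)
  refine ⟨E.commRingCatIsoToRingEquiv, fun r => ?_⟩
  have key : ((Scheme.ΓSpecIso (CommRingCat.of R)).inv ≫ p.appLE ⊤ U le_top) ≫ E.hom =
      CommRingCat.ofHom φ := by
    have h3 : p.appLE ⊤ U le_top ≫ ι.appLE U ⊤ hle = (Spec.map (CommRingCat.ofHom φ)).appTop := by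
      refine (Scheme.Hom.appLE_comp_appLE ι p ⊤ U ⊤ le_top hle).trans ?_
      simp only [hφ]
      exact Scheme.Hom.appLE_eq_app (Spec.map (CommRingCat.ofHom φ))
    rw [Category.assoc, Iso.trans_hom, asIso_hom, reassoc_of% h3, Scheme.ΓSpecIso_naturality,
      Iso.inv_hom_id_assoc]
  exact DFunLike.congr_fun (congrArg CommRingCat.Hom.hom key) r

variable [Algebra ℂ R]

/-- The sections over an open subset as an algebra over the complex numbers. -/
@[reducible]
noncomputable def sectionAlgebra (U : Y.Opens) : Algebra ℂ Γ(Y, U) :=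
  ((pullbackHom p U).comp (algebraMap ℂ R)).toAlgebra

theorem sectionAlgebra_tower {U : Y.Opens} (g : Γ(Y, U)) :
    letI := sectionAlgebra p U
    letI := sectionAlgebra p (Y.basicOpen g)
    IsScalarTower ℂ Γ(Y, U) Γ(Y, Y.basicOpen g) :=
  letI := sectionAlgebra p U
  letI := sectionAlgebra p (Y.basicOpen g)
  IsScalarTower.of_algebraMap_eq fun r =>
    (pullbackHom_restrict p (Y.basicOpen_le g) (algebraMap ℂ R r)).symm

/-- The sections over an open subset are a finitely generated algebra, and the b-function of the
pullback of `h` divides `c` there. -/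
def GoodOpen (h : R) (c : ℂ[X]) (U : Y.Opens) : Prop :=
  ((pullbackHom p U).comp (algebraMap ℂ R)).FiniteType ∧ bFunctionOn p h U ∣ c

variable {p} {h : R} {c : ℂ[X]}

theorem GoodOpen.basicOpen [IsIntegral Y] {V : Y.Opens} (hV : IsAffineOpen V)
    (hc : GoodOpen p h c V) (h0 : pullbackHom p V h ≠ 0) {g : Γ(Y, V)} (hg : g ≠ 0) :
    GoodOpen p h c (Y.basicOpen g) := by
  let _ := sectionAlgebra p V
  let _ := sectionAlgebra p (Y.basicOpen g)
  have htower := sectionAlgebra_tower p g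
  have hne : Nontrivial Γ(Y, V) := ⟨⟨g, 0, hg⟩⟩
  have hVne : Nonempty V := by
    by_contra hemp
    have hbot : V = ⊥ := by
      rwa [← TopologicalSpace.Opens.not_nonempty_iff_eq_bot, ← Set.nonempty_coe_sort]
    have : Subsingleton Γ(Y, V) :=
      CommRingCat.subsingleton_of_isTerminal (Y.sheaf.isTerminalOfEqEmpty hbot)
    exact not_subsingleton _ this
  have hloc : IsLocalization.Away g Γ(Y, Y.basicOpen g) := hV.isLocalization_basicOpen g
  refine ⟨?_, ?_⟩
  · have h1 : Algebra.FiniteType ℂ Γ(Y, V) := RingHom.finiteType_algebraMap.1 hc.1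
    have h2 : Algebra.FiniteType Γ(Y, V) Γ(Y, Y.basicOpen g) :=
      IsLocalization.finiteType_of_monoid_fg (Submonoid.powers g) _
    have h3 : Algebra.FiniteType ℂ Γ(Y, Y.basicOpen g) := Algebra.FiniteType.trans h1 h2
    exact RingHom.finiteType_algebraMap.2 h3
  · have h1 := bFunction_away_dvd Γ(Y, Y.basicOpen g) hg h0 hc.2
    have h2 : algebraMap Γ(Y, V) Γ(Y, Y.basicOpen g) (pullbackHom p V h) =
        pullbackHom p (Y.basicOpen g) h := pullbackHom_restrict p (Y.basicOpen_le g) h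
    rwa [h2] at h1

/-- Around each point, `U` and a member of the cover share an open set that is basic in both; the
divisibility restricts to it from the cover and then glues over `U`. -/
theorem bFunctionOn_dvd_of_cover [IsIntegral Y]
    (hcover : ∀ x : Y, ∃ V : Y.Opens, IsAffineOpen V ∧ x ∈ V ∧ pullbackHom p V h ≠ 0 ∧
      GoodOpen p h c V) {U : Y.Opens} (hU : IsAffineOpen U) [hne : Nonempty U] :
    bFunctionOn p h U ∣ c := by
  let _ := sectionAlgebra p U
  -- Restriction is injective on an integral scheme, so vanishing on `U` would force vanishing on
  -- the members of the cover.
  have h0 : pullbackHom p U h ≠ 0 := by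
    intro hz
    have htop : pullbackHom p ⊤ h = 0 := by
      have hinj := map_injective_of_isIntegral Y (homOfLE (le_top : U ≤ ⊤))
      refine hinj ?_
      rw [map_zero, ← hz]
      exact pullbackHom_restrict p le_top h
    obtain ⟨V, -, -, hV, -⟩ := hcover hne.some.1
    rw [← pullbackHom_restrict p (le_top : V ≤ ⊤), htop, map_zero] at hV
    exact hV rfl
  have hloc : ∀ x : U, ∃ f : Γ(Y, U), x.1 ∈ Y.basicOpen f ∧ GoodOpen p h c (Y.basicOpen f) := by
    intro x
    obtain ⟨V, hV, hxV, hV0, hgood⟩ := hcover x.1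
    obtain ⟨f, g, e, hx⟩ := exists_basicOpen_le_affine_inter hU hV x.1 ⟨x.2, hxV⟩
    refine ⟨f, hx, ?_⟩
    rw [e] at hx ⊢
    refine hgood.basicOpen hV hV0 ?_
    rintro rfl
    rw [Scheme.basicOpen_zero] at hx
    exact hx
  refine bFunction_dvd_of_span_eq_top h0
    (s := {f | f ≠ 0 ∧ GoodOpen p h c (Y.basicOpen f)}) ?_ ?_
  · rw [← hU.self_le_iSup_basicOpen_iff]
    intro x hx
    obtain ⟨f, hxf, hf⟩ := hloc ⟨x, hx⟩
    refine TopologicalSpace.Opens.mem_iSup.2 ⟨⟨f, ?_, hf⟩, hxf⟩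
    rintro rfl
    rw [Scheme.basicOpen_zero] at hxf
    exact hxf
  · rintro f ⟨hf0, hf⟩
    let _ := sectionAlgebra p (Y.basicOpen f)
    refine ⟨hf0, Γ(Y, Y.basicOpen f), inferInstance, sectionAlgebra p (Y.basicOpen f),
      inferInstance, sectionAlgebra_tower p f, hU.isLocalization_basicOpen f, hf.1, ?_⟩
    have h2 : algebraMap Γ(Y, U) Γ(Y, Y.basicOpen f) (pullbackHom p U h) =
        pullbackHom p (Y.basicOpen f) h := pullbackHom_restrict p (Y.basicOpen_le f) h
    rw [h2]
    exact hf.2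

theorem bFunctionOn_bot_dvd {U : Y.Opens} (hU : U = ⊥) : bFunctionOn p h U ∣ c := by
  have : Subsingleton Γ(Y, U) :=
    CommRingCat.subsingleton_of_isTerminal (Y.sheaf.isTerminalOfEqEmpty hU)
  let _ := sectionAlgebra p U
  exact bFunction_dvd_of_subsingleton _ _

end Gluing


/-! ### Integrality of the blow-up. -/

section Integral

variable {R : Type} [CommRing R] {I : Ideal R}

/-- The element `a t` of the Rees algebra. -/
noncomputable def reesElem {a : R} (ha : a ∈ I) : reesAlgebra I :=
  ⟨Polynomial.monomial 1 a, reesAlgebra.monomial_mem.2 (by rwa [pow_one])⟩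

theorem reesElem_mem {a : R} (ha : a ∈ I) : reesElem ha ∈ reesGrading I 1 :=
  (mem_reesGrading I).2 ⟨a, rfl⟩

theorem reesElem_ne_zero {a : R} (ha : a ∈ I) (h0 : a ≠ 0) : reesElem ha ≠ 0 := fun h =>
  h0 ((Polynomial.monomial_eq_zero_iff _ _).1 (congrArg Subtype.val h))

variable [IsDomain R]

/-- The generic point of the blow-up. -/
noncomputable def blowUpGenericPoint {a : R} (ha : a ∈ I) (h0 : a ≠ 0) :
    ProjectiveSpectrum (reesGrading I) where
  asHomogeneousIdeal := ⊥
  isPrime := by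
    rw [HomogeneousIdeal.toIdeal_bot]
    exact Ideal.isPrime_bot
  not_irrelevant_le h := by
    have h1 : reesElem ha ∈ HomogeneousIdeal.irrelevant (reesGrading I) := by
      rw [HomogeneousIdeal.mem_irrelevant_iff, GradedRing.proj_apply,
        DirectSum.decompose_of_mem_ne _ (reesElem_mem ha) one_ne_zero]
    have h2 : reesElem ha ∈ (⊥ : HomogeneousIdeal (reesGrading I)).toIdeal := h h1
    rw [HomogeneousIdeal.toIdeal_bot] at h2
    exact reesElem_ne_zero ha h0 h2

/-- The zero ideal is a point of `Proj`, because `a t ≠ 0` has positive degree, and it lies in every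
nonempty open set. The stalks embed in localizations of the Rees algebra, which is a domain. -/
theorem isIntegral_blowUp {a : R} (ha : a ∈ I) (h0 : a ≠ 0) : IsIntegral (blowUp I) := by
  let η : blowUp I := blowUpGenericPoint ha h0
  have hη : ∀ U : Set (blowUp I), IsOpen U → U.Nonempty → η ∈ U := by
    rintro U hU ⟨x, hx⟩
    obtain ⟨_, ⟨f, rfl⟩, hxf, hfU⟩ :=
      (ProjectiveSpectrum.isTopologicalBasis_basic_opens (reesGrading I)).exists_subset_of_mem_open
        hx hU
    refine hfU ?_
    change f ∉ (⊥ : HomogeneousIdeal (reesGrading I)).toIdeal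
    rw [HomogeneousIdeal.toIdeal_bot]
    intro hf
    rw [Ideal.mem_bot] at hf
    subst hf
    exact hxf (zero_mem _)
  have hirr : IrreducibleSpace (blowUp I) :=
    { isPreirreducible_univ := fun U V hU hV hU' hV' =>
        ⟨η, trivial, hη U hU (hU'.mono Set.inter_subset_right),
          hη V hV (hV'.mono Set.inter_subset_right)⟩
      toNonempty := ⟨η⟩ }
  have hred : ∀ x : blowUp I, _root_.IsReduced ((blowUp I).presheaf.stalk x) := by
    intro x
    let P := (show ProjectiveSpectrum (reesGrading I) from x).asHomogeneousIdeal.toIdeal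
    have hP : P.IsPrime := (show ProjectiveSpectrum (reesGrading I) from x).isPrime
    have h1 : IsDomain (Localization P.primeCompl) :=
      IsLocalization.isDomain_localization P.primeCompl_le_nonZeroDivisors
    have h2 : _root_.IsReduced (HomogeneousLocalization.AtPrime (reesGrading I) P) :=
      ⟨fun z ⟨k, hk⟩ => HomogeneousLocalization.val_injective _ (by
        rw [HomogeneousLocalization.val_zero]
        refine eq_zero_of_pow_eq_zero (n := k) ?_
        rw [← HomogeneousLocalization.val_pow, hk, HomogeneousLocalization.val_zero])⟩
    exact isReduced_of_injective
      (Proj.stalkIso (reesGrading I) x).commRingCatIsoToRingEquiv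
      (Proj.stalkIso (reesGrading I) x).commRingCatIsoToRingEquiv.injective
  have : AlgebraicGeometry.IsReduced (blowUp I) := isReduced_of_isReduced_stalk _
  exact isIntegral_of_irreducibleSpace_of_isReduced _

end Integral

/-! ### The coordinate ring of a chart is a polynomial ring. -/

section ChartRing

variable {n : ℕ} (i j : Fin n)

/-- The pullback of functions to a chart of the blow-up of the diagonal. -/
noncomputable def chartHom : CoordRing n →ₐ[ℂ] CoordRing n :=
  MvPolynomial.aeval fun k => MvPolynomial.X j + MvPolynomial.X i * chartV i j k

theorem chartHom_X (k : Fin n) : chartHom i j (MvPolynomial.X k) =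
    MvPolynomial.X j + MvPolynomial.X i * chartV i j k := MvPolynomial.aeval_X ..

theorem chartHom_sub (k l : Fin n) : chartHom i j (MvPolynomial.X k - MvPolynomial.X l) =
    MvPolynomial.X i * (chartV i j k - chartV i j l) := by
  rw [map_sub, chartHom_X, chartHom_X]
  ring

theorem chartHom_xi : chartHom i j (xi n) = chartFun i j := by
  rw [xi_eq_prod, map_prod, chartFun, ← card_ltPairs, ← Finset.prod_const,
    ← Finset.prod_mul_distrib]
  exact Finset.prod_congr rfl fun q _ => chartHom_sub i j q.1 q.2

variable {i j}

theorem chartHom_injective (hij : i ≠ j) : Function.Injective (chartHom i j) := by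
  let r := ratMap (Fin n)
  have hr : Function.Injective r := IsFractionRing.injective _ _
  let x : Fin n → MvRat (Fin n) := fun k => r (MvPolynomial.X k)
  have hx : x i - x j ≠ 0 := by
    rw [sub_ne_zero]
    exact fun h => hij (MvPolynomial.X_injective (hr h))
  -- The chart is birational: `χ` writes its coordinates as rational functions on the base.
  let χ : CoordRing n →ₐ[ℂ] MvRat (Fin n) := MvPolynomial.aeval fun k =>
    if k = i then x i - x j else if k = j then x j else (x k - x j) / (x i - x j)
  have hi : χ (MvPolynomial.X i) = x i - x j := by
    rw [MvPolynomial.aeval_X, if_pos rfl]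
  have hj : χ (MvPolynomial.X j) = x j := by
    rw [MvPolynomial.aeval_X, if_neg hij.symm, if_pos rfl]
  have hv : ∀ k, χ (chartV i j k) = (x k - x j) / (x i - x j) := by
    intro k
    by_cases h1 : k = i
    · rw [h1, chartV_left, map_one, div_self hx]
    by_cases h2 : k = j
    · rw [h2, chartV_right hij, map_zero, sub_self, zero_div]
    rw [chartV_of_ne h1 h2, MvPolynomial.aeval_X, if_neg h1, if_neg h2]
  have hcomp : χ.comp (chartHom i j) = IsScalarTower.toAlgHom ℂ (CoordRing n) (MvRat (Fin n)) := by
    refine MvPolynomial.algHom_ext fun k => ?_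
    rw [AlgHom.comp_apply, chartHom_X, map_add, map_mul, hi, hj, hv, mul_div_cancel₀ _ hx,
      add_sub_cancel]
    rfl
  intro p q h
  refine hr ?_
  change IsScalarTower.toAlgHom ℂ (CoordRing n) (MvRat (Fin n)) p =
    IsScalarTower.toAlgHom ℂ (CoordRing n) (MvRat (Fin n)) q
  rw [← hcomp, AlgHom.comp_apply, AlgHom.comp_apply, h]

variable (i j) in
theorem sub_mem_diagonalIdeal :
    (MvPolynomial.X i - MvPolynomial.X j : CoordRing n) ∈ diagonalIdeal n :=
  Ideal.subset_span ⟨(i, j), rfl⟩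

theorem pow_dvd_map_of_mem_pow {A B : Type*} [CommRing A] [CommRing B] (φ : A →+* B) {J : Ideal A}
    {b : B} (h : ∀ a ∈ J, b ∣ φ a) {m : ℕ} {a : A} (ha : a ∈ J ^ m) : b ^ m ∣ φ a := by
  have h1 : J.map φ ≤ Ideal.span {b} :=
    Ideal.map_le_iff_le_comap.2 fun a ha => Ideal.mem_span_singleton.2 (h a ha)
  have h2 := Ideal.pow_right_mono h1 m (Ideal.map_pow φ J m ▸ Ideal.mem_map_of_mem φ ha)
  rwa [Ideal.span_singleton_pow, Ideal.mem_span_singleton] at h2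

theorem exists_chartHom_eq {m : ℕ} {r : CoordRing n} (hr : r ∈ diagonalIdeal n ^ m) :
    ∃ s, chartHom i j r = MvPolynomial.X i ^ m * s := by
  refine pow_dvd_map_of_mem_pow (chartHom i j).toRingHom (fun a ha => ?_) hr
  refine Submodule.span_induction (p := fun a _ => MvPolynomial.X i ∣ chartHom i j a)
    ?_ ?_ ?_ ?_ ha
  · rintro _ ⟨q, rfl⟩
    exact ⟨_, chartHom_sub i j q.1 q.2⟩
  · rw [map_zero]
    exact dvd_zero _
  · intro x y _ _ hx hy
    rw [map_add]
    exact dvd_add hx hy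
  · intro a x _ hx
    rw [smul_eq_mul, map_mul]
    exact dvd_mul_of_dvd_right hx _

variable (i j)

/-- The generator of the exceptional divisor in a chart, as an element of the Rees algebra. -/
noncomputable def chartElem : reesAlgebra (diagonalIdeal n) :=
  reesElem (sub_mem_diagonalIdeal i j)

theorem chartElem_mem : chartElem i j ∈ reesGrading (diagonalIdeal n) 1 := reesElem_mem _

/-- The evaluation of the Rees algebra in the field of rational functions of a chart. -/
noncomputable def reesEval : reesAlgebra (diagonalIdeal n) →+* MvRat (Fin n) :=
  (Polynomial.eval₂RingHom ((ratMap (Fin n)).comp (chartHom i j : CoordRing n →+* CoordRing n))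
    (ratMap (Fin n) (MvPolynomial.X i))⁻¹).comp
    ((reesAlgebra (diagonalIdeal n)).val : reesAlgebra (diagonalIdeal n) →+* (CoordRing n)[X])

theorem reesEval_of_monomial {x : reesAlgebra (diagonalIdeal n)} {m : ℕ} {r : CoordRing n}
    (h : Polynomial.monomial m r = (x : (CoordRing n)[X])) : reesEval i j x =
      ratMap (Fin n) (chartHom i j r) * (ratMap (Fin n) (MvPolynomial.X i))⁻¹ ^ m := by
  change Polynomial.eval₂ _ _ (x : (CoordRing n)[X]) = _
  rw [← h, Polynomial.eval₂_monomial]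
  rfl

theorem ratMap_X_ne_zero : ratMap (Fin n) (MvPolynomial.X i) ≠ 0 := by
  simp [MvPolynomial.X_ne_zero]

variable {i j}

theorem reesEval_reesElem (k l : Fin n) :
    reesEval i j (reesElem (sub_mem_diagonalIdeal k l)) =
      ratMap (Fin n) (chartV i j k - chartV i j l) := by
  rw [reesEval_of_monomial i j rfl, chartHom_sub, map_mul, pow_one, mul_comm,
    inv_mul_cancel_left₀ (ratMap_X_ne_zero i)]

/-- Sending `t` to `u⁻¹` normalizes the denominators `u t` to `1`, so a fraction of degree zero is
evaluated through its numerator. -/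
theorem reesEval_chartElem (hij : i ≠ j) : reesEval i j (chartElem i j) = 1 := by
  rw [chartElem, reesEval_reesElem, chartV_left, chartV_right hij, sub_zero, map_one]

/-- The embedding of the coordinate ring of a chart in the field of rational functions. -/
noncomputable def awayEval (hij : i ≠ j) :
    HomogeneousLocalization.Away (reesGrading (diagonalIdeal n)) (chartElem i j) →+*
      MvRat (Fin n) :=
  (Localization.awayLift (reesEval i j) (chartElem i j)
    (by rw [reesEval_chartElem hij]; exact isUnit_one)).comp
    (algebraMap _ (Localization.Away (chartElem i j)))

theorem awayEval_mk (hij : i ≠ j) (m : ℕ) (x : reesAlgebra (diagonalIdeal n))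
    (hx : x ∈ reesGrading (diagonalIdeal n) (m • 1)) :
    awayEval hij (HomogeneousLocalization.Away.mk _ (chartElem_mem i j) m x hx) =
      reesEval i j x := by
  have := Localization.awayLift_mk (reesEval i j) (chartElem i j) x 1
    (by rw [reesEval_chartElem hij, mul_one]) m
  exact this.trans (by rw [one_pow, mul_one])

theorem awayEval_fromZero (hij : i ≠ j) (r : CoordRing n) :
    awayEval hij (HomogeneousLocalization.fromZeroRingHom (reesGrading (diagonalIdeal n)) _
      (algebraMap (CoordRing n) (reesGrading (diagonalIdeal n) 0) r)) =
      ratMap (Fin n) (chartHom i j r) := by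
  have h := awayEval_mk hij 0
    (algebraMap (CoordRing n) (reesGrading (diagonalIdeal n) 0) r : reesAlgebra (diagonalIdeal n))
    (by rw [zero_smul]; exact SetLike.coe_mem _)
  have h2 : (HomogeneousLocalization.Away.mk _ (chartElem_mem i j) 0
      (algebraMap (CoordRing n) (reesGrading (diagonalIdeal n) 0) r : reesAlgebra (diagonalIdeal n))
      (by rw [zero_smul]; exact SetLike.coe_mem _)) =
      HomogeneousLocalization.fromZeroRingHom (reesGrading (diagonalIdeal n)) _
      (algebraMap (CoordRing n) (reesGrading (diagonalIdeal n) 0) r) := by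
    apply HomogeneousLocalization.val_injective
    rw [HomogeneousLocalization.Away.val_mk]
    exact Localization.mk_eq_mk_iff.2 (Localization.r_of_eq (by simp))
  rw [← h2, h, reesEval_of_monomial i j (m := 0) (r := r) rfl, pow_zero, mul_one]

theorem awayEval_injective (hij : i ≠ j) : Function.Injective (awayEval hij) := by
  rw [injective_iff_map_eq_zero]
  intro z hz
  obtain ⟨m, x, hx, rfl⟩ := HomogeneousLocalization.Away.mk_surjective _ (chartElem_mem i j) z
  obtain ⟨r, hr⟩ := (mem_reesGrading _).1 hx
  rw [awayEval_mk, reesEval_of_monomial i j hr, mul_eq_zero, IsFractionRing.to_map_eq_zero_iff] at hz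
  have hr0 : r = 0 := by
    rcases hz with h | h
    · exact chartHom_injective hij (h.trans (map_zero _).symm)
    · exact absurd h (pow_ne_zero _ (inv_ne_zero (ratMap_X_ne_zero i)))
  have hx0 : x = 0 := Subtype.ext (by rw [← hr, hr0, Polynomial.monomial_zero_right]; rfl)
  subst hx0
  apply HomogeneousLocalization.val_injective
  rw [HomogeneousLocalization.Away.val_mk, Localization.mk_zero, HomogeneousLocalization.val_zero]

/-- In a fraction `r t^m / (u t)^m` the numerator has `r ∈ I^m`, and the pullback of `r` is
divisible by `u^m`; so the value is a polynomial. -/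
theorem exists_ratMap_eq_awayEval (hij : i ≠ j)
    (z : HomogeneousLocalization.Away (reesGrading (diagonalIdeal n)) (chartElem i j)) :
    ∃ s, ratMap (Fin n) s = awayEval hij z := by
  obtain ⟨m, x, hx, rfl⟩ := HomogeneousLocalization.Away.mk_surjective _ (chartElem_mem i j) z
  obtain ⟨r, hr⟩ := (mem_reesGrading _).1 hx
  have hrI : r ∈ diagonalIdeal n ^ (m • 1) := by
    have := x.2 (m • 1)
    rwa [← hr, Polynomial.coeff_monomial_same] at this
  obtain ⟨s, hs⟩ := exists_chartHom_eq (i := i) (j := j) hrI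
  refine ⟨s, ?_⟩
  have := pow_ne_zero (m • 1) (ratMap_X_ne_zero i)
  rw [awayEval_mk, reesEval_of_monomial i j hr, hs, map_mul, map_pow, inv_pow,
    mul_comm _ (ratMap (Fin n) s), mul_inv_cancel_right₀ this]

theorem exists_awayEval_eq_ratMap (hij : i ≠ j) (p : CoordRing n) :
    ∃ z, awayEval hij z = ratMap (Fin n) p := by
  induction p using MvPolynomial.induction_on with
  | C a =>
    refine ⟨_, (awayEval_fromZero hij (MvPolynomial.C a)).trans ?_⟩
    rw [MvPolynomial.algHom_C, MvPolynomial.algebraMap_eq]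
  | add p q hp hq =>
    obtain ⟨z, hz⟩ := hp
    obtain ⟨w, hw⟩ := hq
    exact ⟨z + w, by rw [map_add, map_add, hz, hw]⟩
  | mul_X p k hp =>
    obtain ⟨z, hz⟩ := hp
    -- The coordinates come from `x_i - x_j`, `x_j` and the fractions `(x_k - x_j) t / ((x_i - x_j)
    -- t)`.
    obtain ⟨w, hw⟩ : ∃ w, awayEval hij w = ratMap (Fin n) (MvPolynomial.X k) := by
      by_cases h1 : k = i
      · refine ⟨_, (awayEval_fromZero hij (MvPolynomial.X i - MvPolynomial.X j)).trans ?_⟩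
        rw [chartHom_sub, chartV_left, chartV_right hij, sub_zero, mul_one, h1]
      by_cases h2 : k = j
      · refine ⟨_, (awayEval_fromZero hij (MvPolynomial.X j)).trans ?_⟩
        rw [chartHom_X, chartV_right hij, mul_zero, add_zero, h2]
      · refine ⟨_, (awayEval_mk hij 1 (reesElem (sub_mem_diagonalIdeal k j)) (by
          rw [smul_eq_mul, mul_one]; exact reesElem_mem _)).trans ?_⟩
        rw [reesEval_reesElem, chartV_right hij, chartV_of_ne h1 h2, sub_zero]
    exact ⟨z * w, by rw [map_mul, map_mul, hz, hw]⟩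

theorem exists_ringEquiv_of_range_eq {A B K : Type*} [Semiring A] [Semiring B] [Semiring K]
    {f : A →+* K} {g : B →+* K} (hf : Function.Injective f) (hg : Function.Injective g)
    (h₁ : ∀ a, ∃ b, g b = f a) (h₂ : ∀ b, ∃ a, f a = g b) :
    ∃ e : A ≃+* B, ∀ x, g (e x) = f x := by
  choose u hu using h₁
  choose v hv using h₂
  exact ⟨{
    toFun := u
    invFun := v
    left_inv := fun a => hf (by rw [hv, hu])
    right_inv := fun b => hg (by rw [hu, hv])
    map_mul' := fun a b => hg (by rw [hu, map_mul, map_mul, hu, hu])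
    map_add' := fun a b => hg (by rw [hu, map_add, map_add, hu, hu]) }, hu⟩

variable (i j) in
/-- The affine chart of the blow-up where `x_i - x_j` generates the exceptional divisor. -/
noncomputable def chartOpen : (blowUp (diagonalIdeal n)).Opens :=
  Proj.basicOpen (reesGrading (diagonalIdeal n)) (chartElem i j)

variable (i j) in
theorem isAffineOpen_chartOpen : IsAffineOpen (chartOpen i j) :=
  Proj.isAffineOpen_basicOpen _ _ (chartElem_mem i j) one_pos

theorem exists_chart_ringEquiv (hij : i ≠ j) :
    ∃ e : Γ(blowUp (diagonalIdeal n), chartOpen i j) ≃+* CoordRing n,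
      ∀ r, e (pullbackHom (blowDown (diagonalIdeal n)) (chartOpen i j) r) = chartHom i j r := by
  obtain ⟨e, he⟩ := exists_ringEquiv_of_range_eq (awayEval_injective hij)
    (IsFractionRing.injective (CoordRing n) (MvRat (Fin n))) (exists_ratMap_eq_awayEval hij)
    (exists_awayEval_eq_ratMap hij)
  have hφ : Proj.awayι (reesGrading (diagonalIdeal n)) (chartElem i j) (chartElem_mem i j) one_pos ≫
      blowDown (diagonalIdeal n) = Spec.map (CommRingCat.ofHom
        ((HomogeneousLocalization.fromZeroRingHom (reesGrading (diagonalIdeal n)) _).comp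
          (algebraMap (CoordRing n) (reesGrading (diagonalIdeal n) 0)))) :=
    (Proj.awayι_toSpecZero_assoc (reesGrading (diagonalIdeal n)) (chartElem i j)
      (chartElem_mem i j) one_pos _).trans (Spec.map_comp _ _).symm
  let ι : Spec (CommRingCat.of (HomogeneousLocalization.Away (reesGrading (diagonalIdeal n))
      (chartElem i j))) ⟶ blowUp (diagonalIdeal n) :=
    Proj.awayι (reesGrading (diagonalIdeal n)) (chartElem i j) (chartElem_mem i j) one_pos
  have hι : IsOpenImmersion ι := inferInstanceAs (IsOpenImmersion
    (Proj.awayι (reesGrading (diagonalIdeal n)) (chartElem i j) (chartElem_mem i j) one_pos))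
  obtain ⟨e', he'⟩ := exists_ringEquiv_opensRange (blowDown (diagonalIdeal n)) ι _ hφ
    (U := chartOpen i j) (Proj.opensRange_awayι ..).symm
  refine ⟨e'.trans e, fun r => IsFractionRing.injective (CoordRing n) (MvRat (Fin n)) ?_⟩
  exact (he _).trans ((congrArg _ (he' r)).trans (awayEval_fromZero hij r))

end ChartRing


/-! ### The charts cover the blow-up. -/

section Cover

variable {R : Type} [CommRing R] {I : Ideal R} {J : Ideal (reesAlgebra I)}

theorem exists_mem_eq_monomial (h : ∀ b ∈ I, ∃ y ∈ J, (y : R[X]) = Polynomial.monomial 1 b) (m : ℕ)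
    {a : R} (ha : a ∈ I ^ (m + 1)) : ∃ y ∈ J, (y : R[X]) = Polynomial.monomial (m + 1) a := by
  rw [pow_succ] at ha
  refine Submodule.mul_induction_on ha (fun b hb c hc => ?_) fun b c hb hc => ?_
  · obtain ⟨y, hy, hyc⟩ := h c hc
    refine ⟨⟨Polynomial.monomial m b, reesAlgebra.monomial_mem.2 hb⟩ * y,
      J.mul_mem_left _ hy, ?_⟩
    rw [Subalgebra.coe_mul, hyc, Polynomial.monomial_mul_monomial]
  · obtain ⟨y, hy, hyb⟩ := hb
    obtain ⟨z, hz, hzc⟩ := hc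
    exact ⟨y + z, add_mem hy hz, by rw [Subalgebra.coe_add, hyb, hzc, map_add]⟩

theorem irrelevant_reesGrading_le
    (h : ∀ b ∈ I, ∃ y ∈ J, (y : R[X]) = Polynomial.monomial 1 b) :
    (HomogeneousIdeal.irrelevant (reesGrading I)).toIdeal ≤ J := by
  classical
  intro x hx
  rw [← DirectSum.sum_support_decompose (reesGrading I) x]
  refine sum_mem fun k _ => ?_
  rcases k with _ | k
  · have : (DirectSum.decompose (reesGrading I) x 0 : reesAlgebra I) = 0 :=
      (HomogeneousIdeal.mem_irrelevant_iff _ _).1 hx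
    rw [this]
    exact zero_mem _
  · obtain ⟨r, hr⟩ := (mem_reesGrading I).1 (DirectSum.decompose (reesGrading I) x (k + 1)).2
    have hrI : r ∈ I ^ (k + 1) := by
      have := (DirectSum.decompose (reesGrading I) x (k + 1) : reesAlgebra I).2 (k + 1)
      rwa [← hr, Polynomial.coeff_monomial_same] at this
    obtain ⟨y, hy, hyr⟩ := exists_mem_eq_monomial h k hrI
    rwa [Subtype.ext (hyr.trans hr)] at hy

/-- The elements `(x_i - x_j) t` generate the irrelevant ideal, and those with `i = j` are zero, so
their charts are empty. -/
theorem exists_mem_chartOpen {n : ℕ} (x : blowUp (diagonalIdeal n)) :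
    ∃ i j : Fin n, i ≠ j ∧ x ∈ chartOpen i j := by
  have hcov := Proj.iSup_basicOpen_eq_top (reesGrading (diagonalIdeal n))
    (fun q : Fin n × Fin n => chartElem q.1 q.2) (irrelevant_reesGrading_le fun b hb => by
      refine Submodule.span_induction (p := fun b _ =>
        ∃ y ∈ Ideal.span (Set.range fun q : Fin n × Fin n => chartElem q.1 q.2),
          (y : (CoordRing n)[X]) = Polynomial.monomial 1 b) ?_ ?_ ?_ ?_ hb
      · rintro _ ⟨q, rfl⟩
        exact ⟨_, Ideal.subset_span ⟨q, rfl⟩, rfl⟩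
      · exact ⟨0, zero_mem _, by rw [map_zero]; rfl⟩
      · rintro a b _ _ ⟨y, hy, hya⟩ ⟨z, hz, hzb⟩
        exact ⟨y + z, add_mem hy hz, by rw [Subalgebra.coe_add, hya, hzb, map_add]⟩
      · rintro a b _ ⟨y, hy, hyb⟩
        exact ⟨a • y, Submodule.smul_of_tower_mem _ a hy,
          by rw [Subalgebra.coe_smul, hyb, map_smul]⟩)
  obtain ⟨q, hq⟩ := TopologicalSpace.Opens.mem_iSup.1 (hcov.ge (Set.mem_univ x))
  refine ⟨q.1, q.2, fun h => ?_, hq⟩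
  have h0 : chartElem q.1 q.2 = 0 := by
    apply Subtype.ext
    change Polynomial.monomial 1 (MvPolynomial.X q.1 - MvPolynomial.X q.2 : CoordRing n) = 0
    rw [h, sub_self, map_zero]
  refine hq ?_
  rw [h0]
  exact zero_mem _

end Cover

/-! ### Reduction of the blow-up to its charts, and the conclusion. -/

section Charts

variable {n : ℕ}

theorem chart_spec {i j : Fin n} (hij : i ≠ j) (c : ℂ[X]) :
    pullbackHom (blowDown (diagonalIdeal n)) (chartOpen i j) (xi n) ≠ 0 ∧
      ((pullbackHom (blowDown (diagonalIdeal n)) (chartOpen i j)).comp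
        (algebraMap ℂ (CoordRing n))).FiniteType ∧
      (bFunctionOn (blowDown (diagonalIdeal n)) (xi n) (chartOpen i j) ∣ c ↔
        bFunction (chartFun i j) ∣ c) := by
  obtain ⟨e, he⟩ := exists_chart_ringEquiv hij
  let _ := sectionAlgebra (blowDown (diagonalIdeal n)) (chartOpen i j)
  have : IsDomain Γ(blowUp (diagonalIdeal n), chartOpen i j) := e.toMulEquiv.isDomain (CoordRing n)
  let E : Γ(blowUp (diagonalIdeal n), chartOpen i j) ≃ₐ[ℂ] CoordRing n :=
    AlgEquiv.ofRingEquiv (f := e) fun z => (he _).trans (AlgHom.commutes (chartHom i j) z)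
  have hE : E (pullbackHom (blowDown (diagonalIdeal n)) (chartOpen i j) (xi n)) = chartFun i j :=
    (he _).trans (chartHom_xi i j)
  have h0 : pullbackHom (blowDown (diagonalIdeal n)) (chartOpen i j) (xi n) ≠ 0 := by
    intro h
    rw [h, map_zero] at hE
    exact chartFun_ne_zero hij hE.symm
  refine ⟨h0, ?_, ?_⟩
  · have : Algebra.FiniteType ℂ Γ(blowUp (diagonalIdeal n), chartOpen i j) :=
      Algebra.FiniteType.equiv inferInstance E.symm
    exact RingHom.finiteType_algebraMap.2 this
  · rw [← hE]
    exact (bFunction_dvd_of_algEquiv E h0 c).symm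

theorem forall_bFunctionOn_dvd_iff (c : ℂ[X]) :
    (∀ U : (blowUp (diagonalIdeal n)).Opens, IsAffineOpen U →
      bFunctionOn (blowDown (diagonalIdeal n)) (xi n) U ∣ c) ↔
      ∀ i j : Fin n, i ≠ j → bFunction (chartFun i j) ∣ c := by
  refine ⟨fun h i j hij => ?_, fun h U hUaff => ?_⟩
  · obtain ⟨-, -, hb⟩ := chart_spec hij c
    exact hb.1 (h (chartOpen i j) (isAffineOpen_chartOpen i j))
  by_cases hU : Nonempty U
  · obtain ⟨x⟩ := hU
    obtain ⟨i, j, hij, -⟩ := exists_mem_chartOpen x.1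
    have h0 : (MvPolynomial.X i - MvPolynomial.X j : CoordRing n) ≠ 0 :=
      sub_ne_zero.2 fun h => hij (MvPolynomial.X_injective h)
    have : IsIntegral (blowUp (diagonalIdeal n)) := isIntegral_blowUp (sub_mem_diagonalIdeal i j) h0
    have : Nonempty U := ⟨x⟩
    refine bFunctionOn_dvd_of_cover (fun y => ?_) hUaff
    obtain ⟨k, l, hkl, hy⟩ := exists_mem_chartOpen y
    obtain ⟨h0, hft, hb⟩ := chart_spec hkl c
    exact ⟨_, isAffineOpen_chartOpen k l, hy, h0, hft, hb.2 (h k l hkl)⟩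
  · refine bFunctionOn_bot_dvd ?_
    rwa [← TopologicalSpace.Opens.not_nonempty_iff_eq_bot, ← Set.nonempty_coe_sort]

end Charts

section Lcm

theorem polyLcm_dvd_iff {ι : Type*} (b : ι → ℂ[X]) (c : ℂ[X]) :
    polyLcm b ∣ c ↔ ∀ i, b i ∣ c := by
  rw [polyLcm, normalize_dvd_iff, ← Submodule.IsPrincipal.mem_iff_generator_dvd,
    Submodule.mem_iInf]
  exact forall_congr' fun i => Ideal.mem_span_singleton

theorem bFunctionPullback_dvd_iff {R : Type} [CommRing R] [Algebra ℂ R] {Y : Scheme.{0}}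
    (p : Y ⟶ Spec (CommRingCat.of R)) (h : R) (c : ℂ[X]) :
    bFunctionPullback p h ∣ c ↔ ∀ U : Y.Opens, IsAffineOpen U → bFunctionOn p h U ∣ c :=
  (polyLcm_dvd_iff _ c).trans ⟨fun H U hU => H ⟨U, hU⟩, fun H U => H U.1 U.2⟩

theorem normalize_polyLcm {ι : Type*} (b : ι → ℂ[X]) : normalize (polyLcm b) = polyLcm b :=
  normalize_idem _

theorem associated_powPoly (d : ℕ) :
    Associated (∏ i ∈ Finset.Icc 1 d, (X + C ((i : ℂ) / (d : ℂ)))) (powPoly d) := by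
  refine Associated.prod _ _ _ fun t ht => ?_
  have hd : (d : ℂ) ≠ 0 := Nat.cast_ne_zero.2
    (Nat.one_le_iff_ne_zero.1 ((Finset.mem_Icc.1 ht).1.trans (Finset.mem_Icc.1 ht).2))
  refine Associated.symm ⟨(Polynomial.isUnit_C.2 (inv_ne_zero hd).isUnit).unit, ?_⟩
  rw [IsUnit.unit_spec, add_mul, mul_right_comm, ← C_mul, ← C_mul, mul_inv_cancel₀ hd, C_1,
    one_mul, div_eq_mul_inv]

end Lcm

end BernsteinSato

theorem mainTheorem7 (n : ℕ) :
    BernsteinSato.bFunctionPullback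
        (BernsteinSato.blowDown (BernsteinSato.diagonalIdeal n)) (BernsteinSato.xi n) =
      BernsteinSato.polyLcm
          (fun l : {l : n.Partition // l ≠ Nat.Partition.indiscrete n} =>
            BernsteinSato.bFunction (BernsteinSato.xiPartition l.1)) *
        ∏ i ∈ Finset.Icc 1 (n.choose 2),
          (Polynomial.X + Polynomial.C ((i : ℂ) / (n.choose 2 : ℂ))) := by
  open BernsteinSato in
  set L := polyLcm fun l : {l : n.Partition // l ≠ Nat.Partition.indiscrete n} =>
    bFunction (xiPartition l.1) with hL
  -- Both sides have the same multiples and are normalized, hence equal; this includes the case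
  -- where they are zero.
  have hdvd : ∀ c, bFunctionPullback (blowDown (diagonalIdeal n)) (xi n) ∣ c ↔
      L * ∏ i ∈ Finset.Icc 1 (n.choose 2),
        (Polynomial.X + Polynomial.C ((i : ℂ) / (n.choose 2 : ℂ))) ∣ c := by
    intro c
    rw [((associated_powPoly (n.choose 2)).mul_left L).dvd_iff_dvd_left,
      bFunctionPullback_dvd_iff, forall_bFunctionOn_dvd_iff, forall_bFunction_chartFun_dvd_iff]
    constructor
    · rintro ⟨c', rfl, h⟩
      rw [mul_comm]
      exact mul_dvd_mul_left _ ((polyLcm_dvd_iff _ _).2 fun l => h l.1 l.2)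
    · rintro ⟨d, rfl⟩
      exact ⟨L * d, by ring, fun l hl => ((polyLcm_dvd_iff _ _).1 (dvd_refl L) ⟨l, hl⟩).mul_right d⟩
  refine dvd_antisymm_of_normalize_eq (normalize_polyLcm _) ?_ ((hdvd _).2 dvd_rfl)
    ((hdvd _).1 dvd_rfl)
  rw [normalize_mul, hL, normalize_polyLcm, (Polynomial.monic_prod_of_monic _ _ fun i _ =>
    Polynomial.monic_X_add_C _).normalize_eq_self]
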